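/- \textbf{Setting.} For each $n\ge 1$ consider the regression model $\mathbf y=\mathbf f+\boldsymbol\epsilon$ in $\mathbb R^n$ with $\mathbf f=\mathbf X\boldsymbol\beta$, where $\mathbf X=[\mathbf x_1,\dots,\mathbf x_{p_n}]\in\mathbb R^{n\times p_n}$ is nonrandom of full column rank, $1\le p_n\le n$, and $\epsilon_1,\dots,\epsilon_n$ are i.i.d. sub-Gaussian with $\mathbb E\epsilon_i=0$ and $\mathbb E\epsilon_i^2=\sigma^2>0$; $\sigma^2$ and the sub-Gaussian parameter do not depend on $n$. For $0\le k\le p_n$ let $\mathbf P_k$ be the orthogonal projection onto the span of the first $k$ columns of $\mathbf X$ ($\mathbf P_0=\mathbf 0$), write $\mathbf P_j-\mathbf P_{j-1}=\boldsymbol\phi_j\boldsymbol\phi_j^\top$ with $\|\boldsymbol\phi_j\|=1$, and put $\theta_j=\boldsymbol\phi_j^\top\mathbf f/\sqrt n$, $1\le j\le p_n$. For a nested candidate model set $\mathcal M=\{\{1,\dots,k_m\}:1\le m\le M_n\}$ with $1\le k_1<\dots<k_{M_n}\le p_n$ and a weight vector $\mathbf w$ in the unit simplex $\mathcal W_{M_n}$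 of $\mathbb R^{M_n}$, let $\mathbf P_{\mathbf w}=\sum_m w_m\mathbf P_{k_m}$, $\hat{\mathbf f}_{\mathbf w}=\mathbf P_{\mathbf w}\mathbf y$, $L_n(\mathbf w|\mathcal M,\mathbf f)=n^{-1}\|\hat{\mathbf f}_{\mathbf w}-\mathbf f\|^2$, and, for nonrandom $\mathbf w$, $$R_n(\mathbf w|\mathcal M,\mathbf f)=\mathbb E L_n(\mathbf w|\mathcal M,\mathbf f)=\frac1n\|\mathbf f-\mathbf P_{\mathbf w}\mathbf f\|^2+\frac{\sigma^2}n\operatorname{tr}(\mathbf P_{\mathbf w}^\top\mathbf P_{\mathbf w}).$$ Let $\mathbf w^*|\mathcal M$ minimize $R_n(\cdot|\mathcal M,\mathbf f)$ over $\mathcal W_{M_n}$. Given an estimator $\hat\sigma^2$ of $\sigma^2$, let the random vector $\hat{\mathbf w}|\mathcal M$ minimize the Mallows criterion $n^{-1}\|\mathbf y-\hat{\mathbf f}_{\mathbf w}\|^2+2n^{-1}\hat\sigma^2\sum_m k_mw_m$ over $\mathcal W_{M_n}$; the resulting estimator $\hat{\mathbf f}_{\hat{\mathbf w}}$ is the Mallows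 model averaging (MMA) estimator based on $\mathcal M$. Let $Q_n(\hat{\mathbf w}|\mathcal M,\mathbf f)$ denote either of the two quantities $\mathbb E L_n(\hat{\mathbf w}|\mathcal M,\mathbf f)$ and $\mathbb E R_n(\hat{\mathbf w}|\mathcal M,\mathbf f)=n^{-1}\mathbb E\|\mathbf f-\mathbf P_{\hat{\mathbf w}}\mathbf f\|^2+n^{-1}\sigma^2\,\mathbb E\operatorname{tr}(\mathbf P_{\hat{\mathbf w}}^\top\mathbf P_{\hat{\mathbf w}})$. Put $$\psi(\mathcal M)=\Big[M_n\wedge\Big(1+\sum_{j=1}^{M_n-1}\frac{k_{j+1}-k_j}{4k_j}+\sum_{j=1}^{M_n'-1}\frac{S_{j-1}-S_j}{4S_j}\Big)\Big](1+\log M_n)^2,$$ where $k_0=0$, $S_j=\sum_{l=k_j+1}^{k_{M_n}}\theta_l^2$ for $0\le j\le M_n-1$, $S_{M_n}=0$, and $M_n'=\min\{1\le j\le M_n:S_j=0\}$. Let $\mathcal M_A=\{\{1,\dots,j\}:1\le j\le p_n\}$ be the set of all nested models. \textbf{Theorem 3.} Suppose $\limsup_n n^{-1}\|\mathbf f\|^2<\infty$.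 Let $\mathcal M_G=\{\{1,\dots,k_m\}:1\le m\le M_n\}$ be a nested candidate set with $0=k_0<k_1<\dots<k_{M_n}=p_n$ and $$\max_{1\le j\le M_n-1}\frac{k_{j+1}-k_j}{k_j-k_{j-1}}\le 1+\zeta_n,\qquad \zeta_n\ge0 .$$ If $\zeta_n=o(1)$, $\;k_1\vee\psi(\mathcal M_G)=o[nR_n(\mathbf w^*|\mathcal M_A,\mathbf f)]$ and $p_n\,\mathbb E(\hat\sigma^2-\sigma^2)^2=o[nR_n(\mathbf w^*|\mathcal M_A,\mathbf f)]$, then the MMA estimator based on $\mathcal M_G$ achieves the full asymptotic optimality property (AOP): for both choices of $Q_n$, $$Q_n(\hat{\mathbf w}|\mathcal M_G,\mathbf f)\le[1+o(1)]\,R_n(\mathbf w^*|\mathcal M_A,\mathbf f)\qquad(n\to\infty).$$ -/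

import Mathlib

open Filter Topology Asymptotics MeasureTheory ProbabilityTheory Matrix

open scoped NNReal

noncomputable section

namespace MMA

/-- Squared Euclidean norm of a vector in `ℝⁿ`. -/
def sqNorm {n : ℕ} (v : Fin n → ℝ) : ℝ := ∑ i, v i ^ 2

/-- The matrix formed by the columns of the regressor matrix `X` with index in `I`. -/
def subDesign {n p : ℕ} (X : Matrix (Fin n) (Fin p) ℝ) (I : Finset (Fin p)) :
    Matrix (Fin n) {j // j ∈ I} ℝ :=
  X.submatrix id Subtype.val

/-- The least squares hat matrix `X_I (X_Iᵀ X_I)⁻¹ X_Iᵀ` of the model with regressors in `I`. -/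
def hatMatrix {n p : ℕ} (X : Matrix (Fin n) (Fin p) ℝ) (I : Finset (Fin p)) :
    Matrix (Fin n) (Fin n) ℝ :=
  subDesign X I * ((subDesign X I)ᵀ * subDesign X I)⁻¹ * (subDesign X I)ᵀ

/-- The index set of the first `k` regressors. -/
def firstCols (p k : ℕ) : Finset (Fin p) := Finset.univ.filter (fun j => (j : ℕ) < k)

/-- The nested candidate models with sizes `k 1 < k 2 < ⋯ < k M`; the entry `m : Fin M`
(counted from `0`) is the model of size `k (m + 1)`. -/
def nestedModels (p M : ℕ) (k : ℕ → ℕ) : Fin M → Finset (Fin p) :=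
  fun m => firstCols p (k ((m : ℕ) + 1))

/-- The candidate set of all the nested models, with sizes `1, 2, …, p`. -/
def allNested (p : ℕ) : Fin p → Finset (Fin p) := nestedModels p p (fun j => j)

/-- The averaged hat matrix `∑ₘ wₘ P_{I m}`. -/
def avgHat {n p M : ℕ} (X : Matrix (Fin n) (Fin p) ℝ) (I : Fin M → Finset (Fin p))
    (w : Fin M → ℝ) : Matrix (Fin n) (Fin n) ℝ :=
  ∑ m, w m • hatMatrix X (I m)

/-- The model averaging estimator of the mean vector, for the weights `w` and the response `y`. -/
def maEstimator {n p M : ℕ} (X : Matrix (Fin n) (Fin p) ℝ) (I : Fin M → Finset (Fin p))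
    (w : Fin M → ℝ) (y : Fin n → ℝ) : Fin n → ℝ :=
  avgHat X I w *ᵥ y

/-- The normalized squared loss `n⁻¹ ‖g - f‖²`. -/
def loss {n : ℕ} (g f : Fin n → ℝ) : ℝ := sqNorm (g - f) / n

/-- The risk of the model averaging estimator with nonrandom weights `w`, for the response
`f + ε`: the expectation of its loss. -/
def maRisk {n p M : ℕ} {Ω : Type*} [MeasurableSpace Ω] (P : Measure Ω) (ε : Fin n → Ω → ℝ)
    (X : Matrix (Fin n) (Fin p) ℝ) (f : Fin n → ℝ) (I : Fin M → Finset (Fin p))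
    (w : Fin M → ℝ) : ℝ :=
  ∫ ω, loss (maEstimator X I w (fun i => f i + ε i ω)) f ∂P

/-- The expression `n⁻¹ ‖f - P_w f‖² + n⁻¹ σ² tr (P_wᵀ P_w)` into which random weights are
plugged. -/
def plugInRisk {n p M : ℕ} (X : Matrix (Fin n) (Fin p) ℝ) (f : Fin n → ℝ) (σ : ℝ)
    (I : Fin M → Finset (Fin p)) (w : Fin M → ℝ) : ℝ :=
  sqNorm (f - avgHat X I w *ᵥ f) / n + σ ^ 2 / n * ((avgHat X I w)ᵀ * avgHat X I w).trace

/-- The Mallows criterion `n⁻¹ ‖y - f̂_w‖² + 2 n⁻¹ s ∑ₘ |Iₘ| wₘ`, where `s` is the value of the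
variance estimator. -/
def mallows {n p M : ℕ} (X : Matrix (Fin n) (Fin p) ℝ) (I : Fin M → Finset (Fin p))
    (y : Fin n → ℝ) (s : ℝ) (w : Fin M → ℝ) : ℝ :=
  sqNorm (y - maEstimator X I w y) / n + 2 * s / n * ∑ m, ((I m).card : ℝ) * w m

/-- `w` minimizes `F` over the unit simplex of `ℝᴹ`. -/
def IsOptimalWeight {M : ℕ} (F : (Fin M → ℝ) → ℝ) (w : Fin M → ℝ) : Prop :=
  w ∈ stdSimplex ℝ (Fin M) ∧ IsMinOn F (stdSimplex ℝ (Fin M)) w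

/-- `φ` consists of unit vectors `φ_j` with `P_j - P_{j-1} = φ_j φ_jᵀ`, where `P_j` is the hat
matrix of the first `j` regressors (`P_0 = 0`). Indices `j : Fin p` are counted from `0`. -/
def IsIncrementBasis {n p : ℕ} (X : Matrix (Fin n) (Fin p) ℝ) (φ : Fin p → Fin n → ℝ) : Prop :=
  ∀ j : Fin p, sqNorm (φ j) = 1 ∧
    hatMatrix X (firstCols p ((j : ℕ) + 1)) - hatMatrix X (firstCols p (j : ℕ)) =
      vecMulVec (φ j) (φ j)

/-- The transformed coefficients `θ_j = φ_jᵀ f / √n`. -/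
def transformedCoef {n p : ℕ} (φ : Fin p → Fin n → ℝ) (f : Fin n → ℝ) (j : Fin p) : ℝ :=
  (φ j ⬝ᵥ f) / Real.sqrt n

/-- `S_j`, the sum of `θ_l²` over `k_j + 1 ≤ l ≤ k_M` (`l` counted from `1`). -/
def tailSum {p : ℕ} (M : ℕ) (k : ℕ → ℕ) (θ : Fin p → ℝ) (j : ℕ) : ℝ :=
  ∑ l ∈ Finset.univ.filter (fun l : Fin p => k j ≤ (l : ℕ) ∧ (l : ℕ) < k M), θ l ^ 2

/-- `M' = min {1 ≤ j ≤ M : S_j = 0}`; the set contains `M` when `1 ≤ M`. -/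
def tailIndex {p : ℕ} (M : ℕ) (k : ℕ → ℕ) (θ : Fin p → ℝ) : ℕ :=
  sInf {j : ℕ | 1 ≤ j ∧ j ≤ M ∧ tailSum M k θ j = 0}

/-- The complexity `ψ` of the nested candidate set with sizes `k 1 < ⋯ < k M`. -/
def psi {p : ℕ} (M : ℕ) (k : ℕ → ℕ) (θ : Fin p → ℝ) : ℝ :=
  min (M : ℝ)
      (1 + ∑ j ∈ Finset.Ico 1 M, ((k (j + 1) : ℝ) - (k j : ℝ)) / (4 * (k j : ℝ))
        + ∑ j ∈ Finset.Ico 1 (tailIndex M k θ),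
            (tailSum M k θ (j - 1) - tailSum M k θ j) / (4 * tailSum M k θ j))
    * (1 + Real.log M) ^ 2

/-- The numbers `0 = k 0 < k 1 < ⋯ < k M = p` are sizes of grouped nested models, and each group
is at most `1 + ζ` times as large as the preceding one. -/
structure IsGrouped (p M : ℕ) (k : ℕ → ℕ) (ζ : ℝ) : Prop where
  one_le : 1 ≤ M
  zero : k 0 = 0
  lt_succ : ∀ j < M, k j < k (j + 1)
  last : k M = p
  ratio : ∀ j, 1 ≤ j → j + 1 ≤ M →
    ((k (j + 1) : ℝ) - (k j : ℝ)) / ((k j : ℝ) - (k (j - 1) : ℝ)) ≤ 1 + ζ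

/-- Independent identically distributed errors with mean `0` and variance `σ²`, which are
sub-Gaussian with variance proxy `c`. -/
structure IsNoise {n : ℕ} {Ω : Type*} [MeasurableSpace Ω] (P : Measure Ω)
    (ε : Fin n → Ω → ℝ) (c : ℝ≥0) (σ : ℝ) : Prop where
  meas : ∀ i, Measurable (ε i)
  indep : iIndepFun ε P
  ident : ∀ i j, IdentDistrib (ε i) (ε j) P P
  subGaussian : ∀ i, HasSubgaussianMGF (ε i) c P
  mean : ∀ i, ∫ ω, ε i ω ∂P = 0
  variance : ∀ i, ∫ ω, ε i ω ^ 2 ∂P = σ ^ 2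

/-- `Q_n ≤ [1 + o(1)] R_n` as `n → ∞`. -/
def AsympLE (Q R : ℕ → ℝ) : Prop :=
  ∃ δ : ℕ → ℝ, Tendsto δ atTop (𝓝 0) ∧ ∀ᶠ n in atTop, Q n ≤ (1 + δ n) * R n

end MMA

end

set_option linter.unusedSectionVars false

/-! The unit vectors `φ j` are orthonormal, and every averaged projection is diagonal in them: `P_w
= ∑ γ_j φ_j φ_jᵀ`, where `γ_j` is the total weight of the models containing `j`. With `μ_j = φ_j ⬝ᵥ
f` and `ξ_j = φ_j ⬝ᵥ ε`, loss, risk and Mallows criterion become sums over coordinates, and choosing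
weights means choosing a nonincreasing `γ` that starts at `1` and is constant on groups.

Write `v = σ²` and let `s` be the variance estimate. Minimality of the Mallows criterion against a
fixed `γ` bounds the loss of the random `γ̂` by a term of expectation `risk γ`, plus three errors:
`∑ γ̂ (ξ² - v)`, `∑ (1 - γ̂) μ ξ` and `(v - s) ∑ (γ̂ - γ)` (`seqLoss_le`). The third is handled by
Cauchy–Schwarz, which is where `p E(s - v)²` enters. The first two involve data-dependent weights,
so they need bounds uniform over monotone weights.

That bound is `HasIncrementBound.exists_uniform`: `(∑ c_g T_g)² ≤ G ∑ a_g c_g²` simultaneously for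
all nonnegative antitone `c`, with `E G` of the order of the complexity. It combines the
Rademacher–Menshov inequality with a decomposition into stretches on which the partial sums of `a`
double. Group sizes as `a_g` give the first sum in `ψ`; group energies `∑ μ²`, read from the last
group backwards, give the second. Since `∑ a_g c_g²` is then, up to `v`, a part of the risk of `γ̂`,
AM–GM makes each error at most `η · risk γ̂ + O(G / η)`, and the risk term is absorbed
(`oracle_inequality`). The same bounds control `|loss - risk|`, so both versions of `Q_n` are
covered.

Finally the best `γ` over all nested models is replaced on each group by its value at the first
index. Bias does not grow, and the variance grows by at most the factor `1 + ζ` plus `v k_1`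
(`exists_grouped_seqRisk_le`). Dividing by `n` and sending `η` to `0` gives the theorem. -/

namespace MMA

/-! ### Nested projections and the diagonal form of the model. -/

section LinearAlgebra

variable {n p : ℕ}

theorem isUnit_det_gram (X : Matrix (Fin n) (Fin p) ℝ)
    (hX : LinearIndependent ℝ (fun (j : Fin p) (i : Fin n) => X i j)) (I : Finset (Fin p)) :
    IsUnit ((subDesign X I)ᵀ * subDesign X I).det := by
  have hinj : Function.Injective (subDesign X I).mulVec := by
    rw [Matrix.mulVec_injective_iff]
    exact hX.comp (fun j : {j // j ∈ I} => j.1) Subtype.val_injective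
  have h := Matrix.PosDef.conjTranspose_mul_self (subDesign X I) hinj
  rw [conjTranspose_eq_transpose_of_trivial] at h
  exact (Matrix.isUnit_iff_isUnit_det _).1 h.isUnit

theorem hatMatrix_mul_subDesign (X : Matrix (Fin n) (Fin p) ℝ)
    (hX : LinearIndependent ℝ (fun (j : Fin p) (i : Fin n) => X i j)) (I : Finset (Fin p)) :
    hatMatrix X I * subDesign X I = subDesign X I := by
  rw [hatMatrix, Matrix.mul_assoc, Matrix.mul_assoc,
    Matrix.nonsing_inv_mul _ (isUnit_det_gram X hX I), Matrix.mul_one]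

theorem hatMatrix_mul_subDesign_of_subset (X : Matrix (Fin n) (Fin p) ℝ)
    (hX : LinearIndependent ℝ (fun (j : Fin p) (i : Fin n) => X i j)) {I J : Finset (Fin p)}
    (hIJ : I ⊆ J) : hatMatrix X J * subDesign X I = subDesign X I := by
  have h := hatMatrix_mul_subDesign X hX J
  ext i j
  exact congrFun (congrFun h i) ⟨j.1, hIJ j.2⟩

/-- The larger projection fixes the columns of `X_I`, and the smaller one has `X_I` as its left
factor. -/
theorem hatMatrix_mul_of_subset (X : Matrix (Fin n) (Fin p) ℝ)
    (hX : LinearIndependent ℝ (fun (j : Fin p) (i : Fin n) => X i j)) {I J : Finset (Fin p)}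
    (hIJ : I ⊆ J) : hatMatrix X J * hatMatrix X I = hatMatrix X I := by
  conv_lhs => rw [hatMatrix.eq_def X I]
  rw [← Matrix.mul_assoc, ← Matrix.mul_assoc, hatMatrix_mul_subDesign_of_subset X hX hIJ]
  rfl

theorem hatMatrix_transpose (X : Matrix (Fin n) (Fin p) ℝ) (I : Finset (Fin p)) :
    (hatMatrix X I)ᵀ = hatMatrix X I := by
  simp only [hatMatrix, transpose_mul, transpose_transpose, transpose_nonsing_inv,
    Matrix.mul_assoc]

theorem hatMatrix_mul_of_subset' (X : Matrix (Fin n) (Fin p) ℝ)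
    (hX : LinearIndependent ℝ (fun (j : Fin p) (i : Fin n) => X i j)) {I J : Finset (Fin p)}
    (hIJ : I ⊆ J) : hatMatrix X I * hatMatrix X J = hatMatrix X I := by
  have h := congrArg Matrix.transpose (hatMatrix_mul_of_subset X hX hIJ)
  simpa only [transpose_mul, hatMatrix_transpose] using h

theorem firstCols_mono (p : ℕ) {a b : ℕ} (h : a ≤ b) : firstCols p a ⊆ firstCols p b := by
  intro j
  simp only [firstCols, Finset.mem_filter, Finset.mem_univ, true_and]
  omega

theorem hatMatrix_firstCols_zero (X : Matrix (Fin n) (Fin p) ℝ) :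
    hatMatrix X (firstCols p 0) = 0 := by
  have : IsEmpty {j // j ∈ firstCols p 0} := ⟨fun j => by simpa [firstCols] using j.2⟩
  ext i j
  simp [hatMatrix, Matrix.mul_apply]

theorem hatMatrix_mulVec_self (X : Matrix (Fin n) (Fin p) ℝ)
    (hX : LinearIndependent ℝ (fun (j : Fin p) (i : Fin n) => X i j)) (β : Fin p → ℝ) :
    hatMatrix X (firstCols p p) *ᵥ (X *ᵥ β) = X *ᵥ β := by
  have h : hatMatrix X (firstCols p p) * X = X := by
    ext i j
    exact congrFun (congrFun (hatMatrix_mul_subDesign X hX (firstCols p p)) i)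
      ⟨j, by simp [firstCols]⟩
  rw [mulVec_mulVec, h]

variable {X : Matrix (Fin n) (Fin p) ℝ} {φ : Fin p → Fin n → ℝ}

theorem sqNorm_eq_dotProduct (v : Fin n → ℝ) : sqNorm v = v ⬝ᵥ v := by
  simp only [sqNorm, dotProduct, sq]

namespace IsIncrementBasis

/-- Distinct increments of a nested chain of projections multiply to zero. Sandwiching the product
of the two rank-one matrices between `φ i` and `φ j` leaves exactly their inner product. -/
theorem dotProduct_eq_zero (hφ : IsIncrementBasis X φ)
    (hX : LinearIndependent ℝ (fun (j : Fin p) (i : Fin n) => X i j)) {i j : Fin p}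
    (hij : i < j) : φ i ⬝ᵥ φ j = 0 := by
  have hij' : (i : ℕ) + 1 ≤ j := hij
  have h : vecMulVec (φ i) (φ i) * vecMulVec (φ j) (φ j) = 0 := by
    rw [← (hφ i).2, ← (hφ j).2, Matrix.sub_mul, Matrix.mul_sub, Matrix.mul_sub,
      hatMatrix_mul_of_subset' X hX (firstCols_mono p (by omega)),
      hatMatrix_mul_of_subset' X hX (firstCols_mono p (by omega)),
      hatMatrix_mul_of_subset' X hX (firstCols_mono p (by omega)),
      hatMatrix_mul_of_subset' X hX (firstCols_mono p (by omega))]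
    simp
  have h2 := congrArg (fun A => φ i ⬝ᵥ (A *ᵥ φ j)) h
  have h1 := (hφ i).1
  have h1' := (hφ j).1
  rw [sqNorm_eq_dotProduct] at h1 h1'
  simpa [← mulVec_mulVec, vecMulVec_mulVec, h1, h1', dotProduct_smul] using h2

theorem dotProduct_eq (hφ : IsIncrementBasis X φ)
    (hX : LinearIndependent ℝ (fun (j : Fin p) (i : Fin n) => X i j)) (i j : Fin p) :
    φ i ⬝ᵥ φ j = if i = j then 1 else 0 := by
  split_ifs with h
  · subst h
    rw [← sqNorm_eq_dotProduct]
    exact (hφ i).1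
  · rcases lt_or_gt_of_ne h with h | h
    · exact hφ.dotProduct_eq_zero hX h
    · rw [dotProduct_comm]
      exact hφ.dotProduct_eq_zero hX h

theorem hatMatrix_eq (hφ : IsIncrementBasis X φ) (k : ℕ) :
    hatMatrix X (firstCols p k) = ∑ j ∈ firstCols p k, vecMulVec (φ j) (φ j) := by
  induction k with
  | zero => rw [hatMatrix_firstCols_zero]; simp [firstCols]
  | succ k ih =>
    by_cases hk : k < p
    · have h := (hφ ⟨k, hk⟩).2
      have hins : firstCols p (k + 1) = insert ⟨k, hk⟩ (firstCols p k) := by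
        ext j
        simp only [firstCols, Finset.mem_filter, Finset.mem_univ, true_and, Finset.mem_insert,
          Fin.ext_iff]
        omega
      rw [hins, Finset.sum_insert (by simp [firstCols]), ← ih, ← hins, ← h]
      simp
    · have : firstCols p (k + 1) = firstCols p k := by
        ext j
        have := j.2
        simp only [firstCols, Finset.mem_filter, Finset.mem_univ, true_and]
        omega
      rw [this, ih]

end IsIncrementBasis

/-- The factor by which the averaged hat matrix shrinks the `j`-th increment direction. -/
def shrinkage {M : ℕ} (k : ℕ → ℕ) (w : Fin M → ℝ) (j : ℕ) : ℝ :=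
  ∑ m : Fin M, if j < k ((m : ℕ) + 1) then w m else 0

/-- The linear combination of the vectors `φ j` with coefficients `a j`. -/
def combine (φ : Fin p → Fin n → ℝ) (a : Fin p → ℝ) : Fin n → ℝ := ∑ j, a j • φ j

theorem avgHat_eq (hφ : IsIncrementBasis X φ) {M : ℕ} (k : ℕ → ℕ) (w : Fin M → ℝ) :
    avgHat X (nestedModels p M k) w =
      ∑ j : Fin p, shrinkage k w (j : ℕ) • vecMulVec (φ j) (φ j) := by
  simp only [avgHat, nestedModels, hφ.hatMatrix_eq, shrinkage, Finset.sum_smul]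
  simp only [firstCols, Finset.sum_filter, Finset.smul_sum]
  rw [Finset.sum_comm]
  refine Finset.sum_congr rfl fun j _ => Finset.sum_congr rfl fun m _ => ?_
  split_ifs <;> simp

theorem avgHat_mulVec (hφ : IsIncrementBasis X φ) {M : ℕ} (k : ℕ → ℕ) (w : Fin M → ℝ)
    (v : Fin n → ℝ) :
    avgHat X (nestedModels p M k) w *ᵥ v =
      combine φ (fun j : Fin p => shrinkage k w (j : ℕ) * (φ j ⬝ᵥ v)) := by
  rw [avgHat_eq hφ, combine, Matrix.sum_mulVec]
  refine Finset.sum_congr rfl fun j _ => ?_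
  rw [smul_mulVec, vecMulVec_mulVec, mul_smul]
  simp

theorem dotProduct_combine (hφ : IsIncrementBasis X φ)
    (hX : LinearIndependent ℝ (fun (j : Fin p) (i : Fin n) => X i j)) (a : Fin p → ℝ)
    (j : Fin p) : φ j ⬝ᵥ combine φ a = a j := by
  simp [combine, dotProduct_sum, dotProduct_smul, hφ.dotProduct_eq hX]

theorem sqNorm_combine (hφ : IsIncrementBasis X φ)
    (hX : LinearIndependent ℝ (fun (j : Fin p) (i : Fin n) => X i j)) (a : Fin p → ℝ) :
    sqNorm (combine φ a) = ∑ j, a j ^ 2 := by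
  rw [sqNorm_eq_dotProduct]
  conv_lhs => rw [combine.eq_def φ a, sum_dotProduct]
  refine Finset.sum_congr rfl fun j _ => ?_
  rw [smul_dotProduct, ← combine.eq_def φ a, dotProduct_combine hφ hX, smul_eq_mul, sq]

theorem combine_coef (hφ : IsIncrementBasis X φ)
    (hX : LinearIndependent ℝ (fun (j : Fin p) (i : Fin n) => X i j)) (β : Fin p → ℝ) :
    combine φ (fun j => φ j ⬝ᵥ (X *ᵥ β)) = X *ᵥ β := by
  conv_rhs => rw [← hatMatrix_mulVec_self X hX β, hφ.hatMatrix_eq, Matrix.sum_mulVec]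
  rw [combine]
  have : firstCols p p = Finset.univ := by
    ext j; simp [firstCols]
  rw [this]
  refine Finset.sum_congr rfl fun j _ => ?_
  rw [vecMulVec_mulVec]
  simp

theorem combine_sub (a b : Fin p → ℝ) : combine φ a - combine φ b = combine φ (a - b) := by
  simp [combine, sub_smul]

/-- Here `v` need not lie in the span of the `φ j`. The component orthogonal to the span does not
depend on `a`, so it cancels when Mallows criteria are compared. -/
theorem sqNorm_sub_combine (hφ : IsIncrementBasis X φ)
    (hX : LinearIndependent ℝ (fun (j : Fin p) (i : Fin n) => X i j)) (a : Fin p → ℝ)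
    (v : Fin n → ℝ) :
    sqNorm (v - combine φ a) =
      sqNorm v - ∑ j, (φ j ⬝ᵥ v) ^ 2 + ∑ j, ((φ j ⬝ᵥ v) - a j) ^ 2 := by
  have h1 : v ⬝ᵥ combine φ a = ∑ j, a j * (φ j ⬝ᵥ v) := by
    rw [combine, dotProduct_sum]
    exact Finset.sum_congr rfl fun j _ => by
      rw [dotProduct_smul, dotProduct_comm, smul_eq_mul]
  have h2 := sqNorm_combine hφ hX a
  rw [sqNorm_eq_dotProduct] at h2 ⊢
  rw [sub_dotProduct, dotProduct_sub, dotProduct_sub, h2, dotProduct_comm (combine φ a) v, h1,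
    sqNorm_eq_dotProduct]
  have : ∑ j, ((φ j ⬝ᵥ v) - a j) ^ 2 =
      ∑ j, (φ j ⬝ᵥ v) ^ 2 - 2 * ∑ j, a j * (φ j ⬝ᵥ v) + ∑ j, a j ^ 2 := by
    rw [Finset.mul_sum, ← Finset.sum_sub_distrib, ← Finset.sum_add_distrib]
    exact Finset.sum_congr rfl fun j _ => by ring
  rw [this]
  ring

/-- The loss in the coordinates given by the increment directions. -/
theorem loss_maEstimator (hφ : IsIncrementBasis X φ)
    (hX : LinearIndependent ℝ (fun (j : Fin p) (i : Fin n) => X i j)) {M : ℕ} (k : ℕ → ℕ)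
    (w : Fin M → ℝ) (β : Fin p → ℝ) (e : Fin n → ℝ) :
    loss (maEstimator X (nestedModels p M k) w (fun i => (X *ᵥ β) i + e i)) (X *ᵥ β) =
      (∑ j : Fin p, (shrinkage k w (j : ℕ) * (φ j ⬝ᵥ (X *ᵥ β) + φ j ⬝ᵥ e) - φ j ⬝ᵥ (X *ᵥ β)) ^ 2) / n := by
  have h : (fun i => (X *ᵥ β) i + e i) = X *ᵥ β + e := rfl
  have h2 : combine φ (fun j : Fin p => shrinkage k w (j : ℕ) * (φ j ⬝ᵥ (X *ᵥ β + e))) - X *ᵥ β =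
      combine φ ((fun j : Fin p => shrinkage k w (j : ℕ) * (φ j ⬝ᵥ (X *ᵥ β + e))) -
        fun j => φ j ⬝ᵥ (X *ᵥ β)) := by
    rw [← combine_sub, combine_coef hφ hX]
  rw [loss, maEstimator, h, avgHat_mulVec hφ, h2, sqNorm_combine hφ hX]
  simp [dotProduct_add]

theorem plugInRisk_eq (hφ : IsIncrementBasis X φ)
    (hX : LinearIndependent ℝ (fun (j : Fin p) (i : Fin n) => X i j)) {M : ℕ} (k : ℕ → ℕ)
    (w : Fin M → ℝ) (β : Fin p → ℝ) (σ : ℝ) :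
    plugInRisk X (X *ᵥ β) σ (nestedModels p M k) w =
      (∑ j : Fin p, ((1 - shrinkage k w (j : ℕ)) ^ 2 * (φ j ⬝ᵥ (X *ᵥ β)) ^ 2 +
        σ ^ 2 * shrinkage k w (j : ℕ) ^ 2)) / n := by
  have h2 : X *ᵥ β - combine φ (fun j : Fin p => shrinkage k w (j : ℕ) * (φ j ⬝ᵥ (X *ᵥ β))) =
      combine φ ((fun j => φ j ⬝ᵥ (X *ᵥ β)) -
        (fun j : Fin p => shrinkage k w (j : ℕ) * (φ j ⬝ᵥ (X *ᵥ β)))) := by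
    rw [← combine_sub, combine_coef hφ hX]
  have h3 : ((avgHat X (nestedModels p M k) w)ᵀ * avgHat X (nestedModels p M k) w).trace =
      ∑ j : Fin p, shrinkage k w (j : ℕ) ^ 2 := by
    rw [avgHat_eq hφ, transpose_sum, Finset.sum_mul, trace_sum]
    refine Finset.sum_congr rfl fun i _ => ?_
    rw [Finset.mul_sum, trace_sum]
    have : ∀ j : Fin p, ((shrinkage k w i • vecMulVec (φ i) (φ i))ᵀ *
        (shrinkage k w (j : ℕ) • vecMulVec (φ j) (φ j))).trace =
        if i = j then shrinkage k w i * shrinkage k w (j : ℕ) else 0 := by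
      intro j
      simp only [transpose_smul, transpose_vecMulVec, Matrix.smul_mul, Matrix.mul_smul, trace_smul,
        vecMulVec_mul_vecMulVec, trace_vecMulVec, hφ.dotProduct_eq hX, smul_eq_mul,
        dotProduct_smul]
      split_ifs with h
      · subst h
        simp
      · simp
    simp only [this, Finset.sum_ite_eq, Finset.mem_univ, if_true, sq]
  rw [plugInRisk, avgHat_mulVec hφ, h2, sqNorm_combine hφ hX, h3, Finset.sum_add_distrib,
    ← Finset.mul_sum, add_div, div_mul_eq_mul_div]
  congr 2
  refine Finset.sum_congr rfl fun j _ => ?_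
  simp only [Pi.sub_apply]
  ring

theorem mallows_eq (hφ : IsIncrementBasis X φ)
    (hX : LinearIndependent ℝ (fun (j : Fin p) (i : Fin n) => X i j)) {M : ℕ} (k : ℕ → ℕ)
    (w : Fin M → ℝ) (y : Fin n → ℝ) (s : ℝ) :
    mallows X (nestedModels p M k) y s w =
      (sqNorm y - ∑ j : Fin p, (φ j ⬝ᵥ y) ^ 2 + ∑ j : Fin p, ((1 - shrinkage k w (j : ℕ)) ^ 2 * (φ j ⬝ᵥ y) ^ 2 +
        2 * s * shrinkage k w (j : ℕ))) / n := by
  have h : ∑ m, ((nestedModels p M k m).card : ℝ) * w m = ∑ j : Fin p, shrinkage k w (j : ℕ) := by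
    simp only [shrinkage]
    rw [Finset.sum_comm]
    refine Finset.sum_congr rfl fun m _ => ?_
    rw [nestedModels, firstCols, ← Finset.sum_filter, Finset.sum_const, nsmul_eq_mul]
  rw [mallows, h, maEstimator, avgHat_mulVec hφ, sqNorm_sub_combine hφ hX,
    Finset.sum_add_distrib, ← Finset.mul_sum]
  have : ∑ j : Fin p, ((φ j ⬝ᵥ y) - shrinkage k w (j : ℕ) * (φ j ⬝ᵥ y)) ^ 2 =
      ∑ j : Fin p, (1 - shrinkage k w (j : ℕ)) ^ 2 * (φ j ⬝ᵥ y) ^ 2 :=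
    Finset.sum_congr rfl fun j _ => by ring
  rw [this]
  ring

end LinearAlgebra

/-! ### Second moments of linear and quadratic forms in the errors. -/

section Moments

variable {Ω ι : Type*} [MeasurableSpace Ω] {P : Measure Ω} [IsProbabilityMeasure P]
  {ε : ι → Ω → ℝ} {v κ : ℝ}

theorem MemLp.mul_four {f g : Ω → ℝ} (hf : MemLp f 4 P) (hg : MemLp g 4 P) :
    MemLp (fun ω => f ω * g ω) 2 P := by
  have : ENNReal.HolderTriple 4 4 2 := ⟨by
    rw [← two_mul, show (4 : ENNReal) = 2 * 2 by norm_num,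
      ENNReal.mul_inv (by norm_num) (by norm_num), ← mul_assoc,
      ENNReal.mul_inv_cancel (by norm_num) (by norm_num), one_mul]⟩
  exact MemLp.mul hg hf

/-- Independent centered errors with common variance `v` and fourth moments at most `κ`. -/
structure IsFourthMomentNoise (P : Measure Ω) (ε : ι → Ω → ℝ) (v κ : ℝ) : Prop where
  meas : ∀ i, Measurable (ε i)
  indep : iIndepFun ε P
  memLp : ∀ i, MemLp (ε i) 4 P
  mean : ∀ i, ∫ ω, ε i ω ∂P = 0
  variance : ∀ i, ∫ ω, ε i ω ^ 2 ∂P = v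
  fourth : ∀ i, ∫ ω, ε i ω ^ 4 ∂P ≤ κ

namespace IsFourthMomentNoise

variable (h : IsFourthMomentNoise P ε v κ)
include h

theorem memLp_two (i : ι) : MemLp (ε i) 2 P := (h.memLp i).mono_exponent (by norm_num)

theorem memLp_mul (i j : ι) : MemLp (fun ω => ε i ω * ε j ω) 2 P :=
  MemLp.mul_four (h.memLp i) (h.memLp j)

theorem memLp_sq (i : ι) : MemLp (fun ω => ε i ω ^ 2) 2 P := by
  simpa only [sq] using h.memLp_mul i i

theorem integral_sq_sub_sq (i : ι) : ∫ ω, (ε i ω ^ 2 - v) ^ 2 ∂P = ∫ ω, ε i ω ^ 4 ∂P - v ^ 2 := by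
  have h1 : Integrable (fun ω => ε i ω ^ 4) P := by
    have := (h.memLp_sq i).integrable_sq
    simpa only [← pow_mul] using this
  have h2 : Integrable (fun ω => ε i ω ^ 2) P := (h.memLp_sq i).integrable (by norm_num)
  have : ∀ ω, (ε i ω ^ 2 - v) ^ 2 = ε i ω ^ 4 - 2 * v * ε i ω ^ 2 + v ^ 2 := fun ω => by ring
  have h3 : Integrable (fun ω => ε i ω ^ 4 - 2 * v * ε i ω ^ 2) P := h1.sub (h2.const_mul _)
  simp_rw [this]
  rw [integral_add h3 (integrable_const _),
    integral_sub h1 (h2.const_mul _), integral_const_mul, h.variance]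
  simp
  ring

/-- The variance of `ε i ^ 2` is nonnegative. -/
theorem sq_le (i : ι) : v ^ 2 ≤ κ := by
  have h1 := h.integral_sq_sub_sq i
  have h2 : 0 ≤ ∫ ω, (ε i ω ^ 2 - v) ^ 2 ∂P := integral_nonneg fun ω => sq_nonneg _
  linarith [h.fourth i]

theorem integral_mul_eq_mul [DecidableEq ι] {s : Finset ι} {k : ι} (hk : k ∉ s)
    {g : (s → ℝ) → ℝ} (hg : Measurable g) {H : ℝ → ℝ} (hH : Measurable H) :
    ∫ ω, g (fun i => ε i ω) * H (ε k ω) ∂P =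
      (∫ ω, g (fun i => ε i ω) ∂P) * ∫ ω, H (ε k ω) ∂P := by
  have hi := h.indep.indepFun_finset s {k} (by simpa using hk) h.meas
  have hi2 := hi.comp hg (hH.comp (measurable_pi_apply (⟨k, by simp⟩ : ({k} : Finset ι))))
  have := hi2.integral_fun_mul_eq_mul_integral
    (hg.comp (measurable_pi_lambda _ fun i => h.meas i)).aestronglyMeasurable
    (hH.comp (h.meas k)).aestronglyMeasurable
  simpa only [Function.comp] using this

theorem integral_mul_eq_zero [DecidableEq ι] {s : Finset ι} {k : ι} (hk : k ∉ s)
    {g : (s → ℝ) → ℝ} (hg : Measurable g) {H : ℝ → ℝ} (hH : Measurable H)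
    (h0 : ∫ ω, H (ε k ω) ∂P = 0) :
    ∫ ω, g (fun i => ε i ω) * H (ε k ω) ∂P = 0 := by
  rw [h.integral_mul_eq_mul hk hg hH, h0, mul_zero]

theorem memLp_sum_four (a : ι → ℝ) (s : Finset ι) :
    MemLp (fun ω => ∑ i ∈ s, a i * ε i ω) 4 P :=
  memLp_finsetSum _ fun i _ => (h.memLp i).const_mul _

theorem integral_sum_sq (a : ι → ℝ) (s : Finset ι) :
    ∫ ω, (∑ i ∈ s, a i * ε i ω) ^ 2 ∂P = v * ∑ i ∈ s, a i ^ 2 := by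
  classical
  induction s using Finset.induction_on with
  | empty => simp
  | insert k s hk ih =>
    have hL := (h.memLp_sum_four a s).mono_exponent (show (2 : ENNReal) ≤ 4 by norm_num)
    have h1 : Integrable (fun ω => (∑ i ∈ s, a i * ε i ω) ^ 2) P := hL.integrable_sq
    have h2 : Integrable (fun ω => (a k * ε k ω) ^ 2) P :=
      ((h.memLp_two k).const_mul _).integrable_sq
    have h3 : Integrable (fun ω => (∑ i ∈ s, a i * ε i ω) * (a k * ε k ω)) P :=
      hL.integrable_mul ((h.memLp_two k).const_mul _)
    have h4 : ∫ ω, (∑ i ∈ s, a i * ε i ω) * (a k * ε k ω) ∂P = 0 := by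
      have := h.integral_mul_eq_zero hk (g := fun x => ∑ i : s, a i * x i)
        (by fun_prop) (H := fun x => a k * x) (by fun_prop)
        (by rw [integral_const_mul, h.mean, mul_zero])
      simpa only [fun ω => Finset.sum_coe_sort s (fun i => a i * ε i ω)] using this
    have : ∀ ω, (∑ i ∈ insert k s, a i * ε i ω) ^ 2 = (∑ i ∈ s, a i * ε i ω) ^ 2 +
        (a k * ε k ω) ^ 2 + 2 * ((∑ i ∈ s, a i * ε i ω) * (a k * ε k ω)) := fun ω => by
      rw [Finset.sum_insert hk]; ring
    have h5 : Integrable (fun ω => (∑ i ∈ s, a i * ε i ω) ^ 2 + (a k * ε k ω) ^ 2) P := h1.add h2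
    simp_rw [this]
    rw [integral_add h5 (h3.const_mul _), integral_add h1 h2, integral_const_mul, h4, ih,
      Finset.sum_insert hk]
    simp_rw [mul_pow]
    rw [integral_const_mul, h.variance]
    ring

/-- The variance of a quadratic form in independent variables is controlled by the Frobenius
norm. -/
theorem integral_quadratic_sq_le {A : ι → ι → ℝ} (hA : ∀ i j, A i j = A j i) (s : Finset ι) :
    MemLp (fun ω => ∑ i ∈ s, ∑ j ∈ s, A i j * (ε i ω * ε j ω) - v * ∑ i ∈ s, A i i) 2 P ∧
    ∫ ω, (∑ i ∈ s, ∑ j ∈ s, A i j * (ε i ω * ε j ω) - v * ∑ i ∈ s, A i i) ^ 2 ∂P ≤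
      8 * κ * ∑ i ∈ s, ∑ j ∈ s, A i j ^ 2 := by
  classical
  have hmem : ∀ s : Finset ι, MemLp (fun ω => ∑ i ∈ s, ∑ j ∈ s, A i j * (ε i ω * ε j ω) -
      v * ∑ i ∈ s, A i i) 2 P := fun s =>
    MemLp.sub (memLp_finsetSum _ fun i _ => memLp_finsetSum _ fun j _ =>
      (h.memLp_mul i j).const_mul _) (memLp_const _)
  refine ⟨hmem s, ?_⟩
  induction s using Finset.induction_on with
  | empty => simp
  | insert k s hk ih =>
    set Q : Ω → ℝ := fun ω => ∑ i ∈ s, ∑ j ∈ s, A i j * (ε i ω * ε j ω) - v * ∑ i ∈ s, A i i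
      with hQ
    set L : Ω → ℝ := fun ω => ∑ i ∈ s, A i k * ε i ω with hL
    have hQm : MemLp Q 2 P := hmem s
    have hLm4 : MemLp L 4 P := h.memLp_sum_four _ s
    have hLe : MemLp (fun ω => L ω * ε k ω) 2 P := MemLp.mul_four hLm4 (h.memLp k)
    have hc : MemLp (fun ω => ε k ω ^ 2 - v) 2 P := (h.memLp_sq k).sub (memLp_const _)
    -- The new index adds a martingale-type increment: `Q` and `L` involve only the old variables,
    -- so `Q` is uncorrelated with both new terms.
    have hexp : ∀ ω, ∑ i ∈ insert k s, ∑ j ∈ insert k s, A i j * (ε i ω * ε j ω) -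
        v * ∑ i ∈ insert k s, A i i =
        Q ω + (2 * (L ω * ε k ω) + A k k * (ε k ω ^ 2 - v)) := by
      intro ω
      simp only [Finset.sum_insert hk, Finset.sum_add_distrib, hQ, hL, Finset.sum_mul]
      have e1 : ∑ j ∈ s, A k j * (ε k ω * ε j ω) = ∑ i ∈ s, A i k * ε i ω * ε k ω :=
        Finset.sum_congr rfl fun j _ => by rw [hA k j]; ring
      have e2 : ∑ i ∈ s, A i k * (ε i ω * ε k ω) = ∑ i ∈ s, A i k * ε i ω * ε k ω :=
        Finset.sum_congr rfl fun j _ => by ring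
      rw [e1, e2]
      ring
    have hz1 : ∫ ω, (Q ω * L ω) * ε k ω ∂P = 0 := by
      have := h.integral_mul_eq_zero hk
        (g := fun x => (∑ i : s, ∑ j : s, A i j * (x i * x j) - v * ∑ i ∈ s, A i i) *
          ∑ i : s, A i k * x i) (by fun_prop) (H := fun x => x) measurable_id (h.mean k)
      simp only [fun ω => Finset.sum_coe_sort s (fun i => A i k * ε i ω)] at this
      rw [← this]
      congr 1
      ext ω
      simp_rw [fun i => Finset.sum_coe_sort s (fun j => A i j * (ε i ω * ε j ω))]
      simp only [hQ, hL]
      rw [Finset.sum_coe_sort s (fun i => ∑ j ∈ s, A i j * (ε i ω * ε j ω))]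
    have hz2 : ∫ ω, Q ω * (ε k ω ^ 2 - v) ∂P = 0 := by
      have := h.integral_mul_eq_zero hk
        (g := fun x => (∑ i : s, ∑ j : s, A i j * (x i * x j) - v * ∑ i ∈ s, A i i))
        (by fun_prop) (H := fun x => x ^ 2 - v) (by fun_prop) (by
          rw [integral_sub ((h.memLp_sq k).integrable (by norm_num)) (integrable_const _),
            h.variance]
          simp)
      rw [← this]
      congr 1
      ext ω
      simp_rw [fun i => Finset.sum_coe_sort s (fun j => A i j * (ε i ω * ε j ω))]
      simp only [hQ]
      rw [Finset.sum_coe_sort s (fun i => ∑ j ∈ s, A i j * (ε i ω * ε j ω))]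
    have hz3 : ∫ ω, (L ω * ε k ω) ^ 2 ∂P = (v * ∑ i ∈ s, A i k ^ 2) * v := by
      have := h.integral_mul_eq_mul hk (g := fun x => (∑ i : s, A i k * x i) ^ 2)
        (by fun_prop) (H := fun x => x ^ 2) (by fun_prop)
      simp only [fun ω => Finset.sum_coe_sort s (fun i => A i k * ε i ω), h.integral_sum_sq,
        h.variance] at this
      simp_rw [mul_pow]
      exact this
    have hz4 := h.integral_sq_sub_sq k
    have i1 : Integrable (fun ω => Q ω ^ 2) P := hQm.integrable_sq
    have i2 : Integrable (fun ω => (L ω * ε k ω) ^ 2) P := hLe.integrable_sq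
    have i3 : Integrable (fun ω => (ε k ω ^ 2 - v) ^ 2) P := hc.integrable_sq
    have i4 : Integrable (fun ω => (Q ω * L ω) * ε k ω) P := by
      have : Integrable (fun ω => Q ω * (L ω * ε k ω)) P := hQm.integrable_mul hLe
      simpa only [mul_assoc] using this
    have i5 : Integrable (fun ω => Q ω * (ε k ω ^ 2 - v)) P := hQm.integrable_mul hc
    have hle : ∫ ω, (∑ i ∈ insert k s, ∑ j ∈ insert k s, A i j * (ε i ω * ε j ω) -
        v * ∑ i ∈ insert k s, A i i) ^ 2 ∂P ≤
        ∫ ω, (Q ω ^ 2 + (4 * ((Q ω * L ω) * ε k ω) + 2 * A k k * (Q ω * (ε k ω ^ 2 - v))) +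
          (8 * (L ω * ε k ω) ^ 2 + 2 * A k k ^ 2 * (ε k ω ^ 2 - v) ^ 2)) ∂P := by
      refine integral_mono (hmem (insert k s)).integrable_sq
        ((i1.add ((i4.const_mul _).add (i5.const_mul _))).add
          ((i2.const_mul _).add (i3.const_mul _))) fun ω => ?_
      simp only [hexp]
      -- This is `(2a + b)² ≤ 8a² + 2b²` for the square of the increment; the cross terms with `Q`
      -- are kept because they integrate to zero.
      nlinarith [sq_nonneg (2 * (L ω * ε k ω) - A k k * (ε k ω ^ 2 - v))]
    have hcalc : ∫ ω, (Q ω ^ 2 + (4 * ((Q ω * L ω) * ε k ω) +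
          2 * A k k * (Q ω * (ε k ω ^ 2 - v))) +
          (8 * (L ω * ε k ω) ^ 2 + 2 * A k k ^ 2 * (ε k ω ^ 2 - v) ^ 2)) ∂P =
        ∫ ω, Q ω ^ 2 ∂P + (8 * ((v * ∑ i ∈ s, A i k ^ 2) * v) +
          2 * A k k ^ 2 * (∫ ω, ε k ω ^ 4 ∂P - v ^ 2)) := by
      have j1 : Integrable (fun ω => 4 * ((Q ω * L ω) * ε k ω) +
          2 * A k k * (Q ω * (ε k ω ^ 2 - v))) P := (i4.const_mul _).add (i5.const_mul _)
      have j2 : Integrable (fun ω => 8 * (L ω * ε k ω) ^ 2 +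
          2 * A k k ^ 2 * (ε k ω ^ 2 - v) ^ 2) P := (i2.const_mul _).add (i3.const_mul _)
      have j3 : Integrable (fun ω => Q ω ^ 2 + (4 * ((Q ω * L ω) * ε k ω) +
          2 * A k k * (Q ω * (ε k ω ^ 2 - v)))) P := i1.add j1
      rw [integral_add j3 j2, integral_add i1 j1,
        integral_add (i4.const_mul _) (i5.const_mul _),
        integral_add (i2.const_mul _) (i3.const_mul _)]
      simp only [integral_const_mul, hz1, hz2, hz3, hz4]
      ring
    rw [hcalc] at hle
    refine hle.trans ?_
    have hsum : ∑ i ∈ insert k s, ∑ j ∈ insert k s, A i j ^ 2 =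
        ∑ i ∈ s, ∑ j ∈ s, A i j ^ 2 + 2 * ∑ i ∈ s, A i k ^ 2 + A k k ^ 2 := by
      simp only [Finset.sum_insert hk, Finset.sum_add_distrib]
      have : ∑ j ∈ s, A k j ^ 2 = ∑ i ∈ s, A i k ^ 2 :=
        Finset.sum_congr rfl fun j _ => by rw [hA k j]
      rw [this]
      ring
    rw [hsum]
    have hS : 0 ≤ ∑ i ∈ s, A i k ^ 2 := Finset.sum_nonneg fun i _ => sq_nonneg _
    have hv := h.sq_le k
    have h4 := h.fourth k
    have hκ : 0 ≤ κ := (sq_nonneg v).trans hv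
    have m1 := mul_le_mul_of_nonneg_right hv hS
    have m2 : A k k ^ 2 * (∫ ω, ε k ω ^ 4 ∂P - v ^ 2) ≤ A k k ^ 2 * κ :=
      mul_le_mul_of_nonneg_left (by nlinarith [sq_nonneg v]) (sq_nonneg _)
    have m3 := mul_nonneg hκ hS
    have m4 := mul_nonneg hκ (sq_nonneg (A k k))
    nlinarith

end IsFourthMomentNoise

section Orthonormal

variable {n p : ℕ} {e : Fin n → Ω → ℝ} {φ : Fin p → Fin n → ℝ}

theorem IsFourthMomentNoise.integral_linear_sq (h : IsFourthMomentNoise P e v κ)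
    (hφ : ∀ i j, φ i ⬝ᵥ φ j = if i = j then 1 else 0) (a : Fin p → ℝ) (I : Finset (Fin p)) :
    ∫ ω, (∑ j ∈ I, a j * (φ j ⬝ᵥ fun i => e i ω)) ^ 2 ∂P = v * ∑ j ∈ I, a j ^ 2 := by
  have h1 : ∀ ω, ∑ j ∈ I, a j * (φ j ⬝ᵥ fun i => e i ω) =
      ∑ i, (∑ j ∈ I, a j * φ j i) * e i ω := fun ω => by
    simp only [dotProduct, Finset.mul_sum, Finset.sum_mul]
    rw [Finset.sum_comm]
    exact Finset.sum_congr rfl fun i _ => Finset.sum_congr rfl fun j _ => by ring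
  simp_rw [h1]
  rw [h.integral_sum_sq]
  congr 1
  have h2 : ∑ i, (∑ j ∈ I, a j * φ j i) ^ 2 = ∑ j ∈ I, ∑ l ∈ I, a j * a l * (φ j ⬝ᵥ φ l) := by
    simp only [sq, Finset.sum_mul_sum]
    simp only [dotProduct, Finset.mul_sum]
    rw [Finset.sum_comm]
    refine Finset.sum_congr rfl fun j _ => ?_
    rw [Finset.sum_comm]
    exact Finset.sum_congr rfl fun l _ => Finset.sum_congr rfl fun i _ => by ring
  rw [h2]
  refine Finset.sum_congr rfl fun j hj => ?_
  simp only [hφ, mul_ite, mul_one, mul_zero, Finset.sum_ite_eq, hj, if_true, sq]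

/-- The sum is a centered quadratic form whose matrix is an orthogonal projection of rank `I.card`,
so both its trace and its squared Frobenius norm equal `I.card`. -/
theorem IsFourthMomentNoise.integral_chiSquare_sq_le (h : IsFourthMomentNoise P e v κ)
    (hφ : ∀ i j, φ i ⬝ᵥ φ j = if i = j then 1 else 0) (I : Finset (Fin p)) :
    MemLp (fun ω => ∑ j ∈ I, ((φ j ⬝ᵥ fun i => e i ω) ^ 2 - v)) 2 P ∧
    ∫ ω, (∑ j ∈ I, ((φ j ⬝ᵥ fun i => e i ω) ^ 2 - v)) ^ 2 ∂P ≤ 8 * κ * I.card := by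
  set A : Fin n → Fin n → ℝ := fun i l => ∑ j ∈ I, φ j i * φ j l with hA
  have hdiag : ∀ j, ∑ i, φ j i * φ j i = 1 := fun j => by
    have := hφ j j
    simpa [dotProduct] using this
  have h1 : ∀ ω, ∑ j ∈ I, ((φ j ⬝ᵥ fun i => e i ω) ^ 2 - v) =
      ∑ i, ∑ l, A i l * (e i ω * e l ω) - v * ∑ i, A i i := fun ω => by
    have e1 : ∑ i, A i i = I.card := by
      simp only [hA]
      rw [Finset.sum_comm]
      simp [hdiag]
    have e2 : ∑ i, ∑ l, A i l * (e i ω * e l ω) = ∑ j ∈ I, (φ j ⬝ᵥ fun i => e i ω) ^ 2 := by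
      simp only [sq, dotProduct, Finset.sum_mul_sum]
      simp only [hA, Finset.sum_mul]
      rw [Finset.sum_comm (s := I)]
      refine Finset.sum_congr rfl fun i _ => ?_
      rw [Finset.sum_comm]
      exact Finset.sum_congr rfl fun l _ => Finset.sum_congr rfl fun j _ => by ring
    rw [e1, e2, Finset.sum_sub_distrib]
    simp [mul_comm]
  have h2 : ∑ i, ∑ l, A i l ^ 2 = I.card := by
    have : ∀ i l, A i l ^ 2 = ∑ j ∈ I, ∑ m ∈ I, (φ j i * φ m i) * (φ j l * φ m l) := fun i l => by
      simp only [hA, sq, Finset.sum_mul_sum]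
      exact Finset.sum_congr rfl fun j _ => Finset.sum_congr rfl fun m _ => by ring
    calc ∑ i, ∑ l, A i l ^ 2
        = ∑ i, ∑ j ∈ I, ∑ m ∈ I, (φ j i * φ m i) * (φ j ⬝ᵥ φ m) := by
          refine Finset.sum_congr rfl fun i _ => ?_
          simp only [this]
          rw [Finset.sum_comm]
          refine Finset.sum_congr rfl fun j _ => ?_
          rw [Finset.sum_comm]
          exact Finset.sum_congr rfl fun m _ => by rw [dotProduct, Finset.mul_sum]
      _ = ∑ i, ∑ j ∈ I, φ j i * φ j i := by
          refine Finset.sum_congr rfl fun i _ => Finset.sum_congr rfl fun j hj => ?_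
          simp only [hφ, mul_ite, mul_one, mul_zero, Finset.sum_ite_eq, hj, if_true]
      _ = I.card := by
          rw [Finset.sum_comm]
          simp [hdiag]
  have := h.integral_quadratic_sq_le (A := A)
    (fun i l => Finset.sum_congr rfl fun j _ => mul_comm _ _) Finset.univ
  simp_rw [h1]
  rw [h2] at this
  exact this

end Orthonormal

/-- From `x⁴ / 4! ≤ exp |x| ≤ exp x + exp (-x)` and the moment generating function at `±1`; the
constant is `2 · 24`. -/
theorem fourth_moment_le {X : Ω → ℝ} {c : ℝ≥0} (hX : HasSubgaussianMGF X c P) :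
    ∫ ω, X ω ^ 4 ∂P ≤ 48 * Real.exp (c / 2) := by
  have hint : Integrable (fun ω => X ω ^ 4) P := by
    have := (hX.memLp 4).integrable_norm_pow (by norm_num)
    refine this.congr (ae_of_all _ fun ω => ?_)
    simp [Even.pow_abs (show Even 4 by decide)]
  have h1 : Integrable (fun ω => Real.exp (1 * X ω)) P := hX.integrable_exp_mul 1
  have h2 : Integrable (fun ω => Real.exp (-1 * X ω)) P := hX.integrable_exp_mul (-1)
  have hle : ∫ ω, X ω ^ 4 ∂P ≤
      ∫ ω, (24 * Real.exp (1 * X ω) + 24 * Real.exp (-1 * X ω)) ∂P := by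
    refine integral_mono hint ((h1.const_mul _).add (h2.const_mul _)) fun ω => ?_
    have key : ∀ x : ℝ, 0 ≤ x → x ^ 4 ≤ 24 * Real.exp x + 24 * Real.exp (-x) := fun x hx => by
      have hq := Real.pow_div_factorial_le_exp x hx 4
      have hl := Real.exp_pos (-x)
      norm_num [Nat.factorial] at hq
      linarith
    rcases le_total 0 (X ω) with h0 | h0
    · simpa using key _ h0
    · have := key (-X ω) (by linarith)
      simp only [neg_neg] at this
      calc X ω ^ 4 = (-X ω) ^ 4 := by ring
        _ ≤ _ := by simp only [one_mul, neg_mul]; linarith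
  refine hle.trans ?_
  rw [integral_add (h1.const_mul _) (h2.const_mul _), integral_const_mul, integral_const_mul]
  have m1 := hX.mgf_le 1
  have m2 := hX.mgf_le (-1)
  simp only [mgf] at m1 m2
  norm_num at m1 m2 ⊢
  linarith

theorem IsNoise.isFourthMomentNoise {n : ℕ} {e : Fin n → Ω → ℝ} {c : ℝ≥0} {σ : ℝ}
    (h : IsNoise P e c σ) :
    IsFourthMomentNoise P e (σ ^ 2) (48 * Real.exp (c / 2)) where
  meas := h.meas
  indep := h.indep
  memLp i := (h.subGaussian i).memLp 4
  mean := h.mean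
  variance := h.variance
  fourth i := fourth_moment_le (h.subGaussian i)

end Moments

/-! ### A maximal inequality uniform over monotone weights. -/

section Maximal

/-- Cauchy–Schwarz for two terms. It glues bounds on consecutive stretches, adding the random
factors and the deterministic ones separately. -/
theorem sq_add_le_mul_add {x y a b c d : ℝ} (ha : 0 ≤ a) (hb : 0 ≤ b) (hc : 0 ≤ c) (hd : 0 ≤ d)
    (hx : x ^ 2 ≤ a * b) (hy : y ^ 2 ≤ c * d) : (x + y) ^ 2 ≤ (a + c) * (b + d) := by
  have h1 : (x * y) ^ 2 ≤ ((a * d + c * b) / 2) ^ 2 := by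
    have : (x * y) ^ 2 ≤ (a * b) * (c * d) := by
      rw [mul_pow]
      exact mul_le_mul hx hy (sq_nonneg _) (mul_nonneg ha hb)
    nlinarith [sq_nonneg (a * d - c * b)]
  have h2 : x * y ≤ (a * d + c * b) / 2 := by
    have := abs_le_of_sq_le_sq h1 (by positivity)
    exact (le_abs_self _).trans this
  nlinarith

/-- Summation by parts: a nonnegative antitone weight sequence costs at most its first value. -/
theorem sq_sum_mul_le {γ T : ℕ → ℝ} (hγ : Antitone γ) (hγ0 : ∀ i, 0 ≤ γ i) {u v : ℕ} (huv : u ≤ v)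
    {G : ℝ} (hG : ∀ m, u ≤ m → m ≤ v → (∑ i ∈ Finset.Ico u m, T i) ^ 2 ≤ G) :
    (∑ i ∈ Finset.Ico u v, γ i * T i) ^ 2 ≤ γ u ^ 2 * G := by
  have hG0 : 0 ≤ G := (sq_nonneg _).trans (hG u le_rfl huv)
  have hW : ∀ m, u ≤ m → m ≤ v → |∑ i ∈ Finset.Ico u m, T i| ≤ √G := fun m h1 h2 =>
    Real.abs_le_sqrt (hG m h1 h2)
  -- Abel summation: the deviation from the boundary term is a sum of partial sums against the
  -- increments of `γ`, which telescope.
  have key : ∀ m, u ≤ m → m ≤ v →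
      |∑ i ∈ Finset.Ico u m, γ i * T i - γ m * ∑ i ∈ Finset.Ico u m, T i| ≤
        (γ u - γ m) * √G := by
    intro m hm
    induction m, hm using Nat.le_induction with
    | base => simp
    | succ m hm ih =>
      intro hmv
      have h1 := ih (by omega)
      have h2 := hW (m + 1) (by omega) hmv
      rw [Finset.sum_Ico_succ_top hm] at h2 ⊢
      rw [Finset.sum_Ico_succ_top hm]
      have h3 : 0 ≤ γ m - γ (m + 1) := sub_nonneg.2 (hγ (Nat.le_succ m))
      calc _ = |(∑ i ∈ Finset.Ico u m, γ i * T i - γ m * ∑ i ∈ Finset.Ico u m, T i) +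
            (γ m - γ (m + 1)) * (∑ i ∈ Finset.Ico u m, T i + T m)| := by congr 1; ring
        _ ≤ (γ u - γ m) * √G + (γ m - γ (m + 1)) * √G := by
          refine (abs_add_le _ _).trans (add_le_add h1 ?_)
          rw [abs_mul, abs_of_nonneg h3]
          exact mul_le_mul_of_nonneg_left h2 h3
        _ = _ := by ring
  have h1 := key v huv le_rfl
  have h2 := hW v huv le_rfl
  have h3 : |∑ i ∈ Finset.Ico u v, γ i * T i| ≤ γ u * √G := by
    calc _ = |(∑ i ∈ Finset.Ico u v, γ i * T i - γ v * ∑ i ∈ Finset.Ico u v, T i) +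
          γ v * ∑ i ∈ Finset.Ico u v, T i| := by congr 1; ring
      _ ≤ (γ u - γ v) * √G + γ v * √G := by
        refine (abs_add_le _ _).trans (add_le_add h1 ?_)
        rw [abs_mul, abs_of_nonneg (hγ0 v)]
        exact mul_le_mul_of_nonneg_left h2 (hγ0 v)
      _ = _ := by ring
  calc _ = |∑ i ∈ Finset.Ico u v, γ i * T i| ^ 2 := (sq_abs _).symm
    _ ≤ (γ u * √G) ^ 2 := pow_le_pow_left₀ (abs_nonneg _) h3 2
    _ = γ u ^ 2 * G := by rw [mul_pow, Real.sq_sqrt hG0]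

variable {Ω : Type*} [MeasurableSpace Ω] {P : Measure Ω}

/-- The partial sums of `T 0, …, T (N - 1)` over intervals have second moments at most `C` times
the sums of the nonnegative numbers `a i`. -/
structure HasIncrementBound (P : Measure Ω) (T : ℕ → Ω → ℝ) (a : ℕ → ℝ) (C : ℝ) (N : ℕ) :
    Prop where
  memLp : ∀ i, MemLp (T i) 2 P
  nonneg : ∀ i, 0 ≤ a i
  const_nonneg : 0 ≤ C
  le : ∀ u v, u ≤ v → v ≤ N →
    ∫ ω, (∑ i ∈ Finset.Ico u v, T i ω) ^ 2 ∂P ≤ C * ∑ i ∈ Finset.Ico u v, a i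

namespace HasIncrementBound

variable {T : ℕ → Ω → ℝ} {a : ℕ → ℝ} {C : ℝ} {N : ℕ} (h : HasIncrementBound P T a C N)
include h

theorem memLp_sum (s : Finset ℕ) : MemLp (fun ω => ∑ i ∈ s, T i ω) 2 P :=
  memLp_finsetSum _ fun i _ => h.memLp i

theorem integral_sq_le {i : ℕ} (hi : i < N) : ∫ ω, T i ω ^ 2 ∂P ≤ C * a i := by
  simpa using h.le i (i + 1) (by omega) hi

/-- The Rademacher–Menshov maximal inequality. -/
theorem exists_maximal (s : ℕ) : ∀ u v, u ≤ v → v ≤ N → v ≤ u + 2 ^ s →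
    ∃ G : Ω → ℝ, Integrable G P ∧ (∀ ω, 0 ≤ G ω) ∧
      (∀ ω m, u ≤ m → m ≤ v → (∑ i ∈ Finset.Ico u m, T i ω) ^ 2 ≤ G ω) ∧
      ∫ ω, G ω ∂P ≤ ((s : ℝ) + 1) ^ 2 * C * ∑ i ∈ Finset.Ico u v, a i := by
  induction s with
  | zero =>
    intro u v huv hvN hs
    refine ⟨fun ω => (∑ i ∈ Finset.Ico u v, T i ω) ^ 2, (h.memLp_sum _).integrable_sq,
      fun ω => sq_nonneg _, fun ω m h1 h2 => ?_, by simpa using h.le u v huv hvN⟩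
    rcases eq_or_lt_of_le h2 with rfl | h3
    · exact le_rfl
    · have : m = u := by simp at hs; omega
      subst this
      simpa using sq_nonneg _
  | succ s ih =>
    intro u v huv hvN hs
    -- Bisection: a partial sum ending in the right half is the whole left sum `W` plus a partial
    -- sum of the right half.
    obtain ⟨w, huw, hwv, hw1, hw2⟩ : ∃ w, u ≤ w ∧ w ≤ v ∧ w ≤ u + 2 ^ s ∧ v ≤ w + 2 ^ s :=
      ⟨min v (u + 2 ^ s), by omega, by omega, by omega, by rw [pow_succ] at hs; omega⟩
    obtain ⟨G1, i1, n1, m1, e1⟩ := ih u w huw (hwv.trans hvN) hw1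
    obtain ⟨G2, i2, n2, m2, e2⟩ := ih w v hwv hvN hw2
    have iW : Integrable (fun ω => (∑ i ∈ Finset.Ico u w, T i ω) ^ 2) P :=
      (h.memLp_sum _).integrable_sq
    have eW := h.le u w huw (hwv.trans hvN)
    have hs0 : (0 : ℝ) < (s : ℝ) + 1 := by positivity
    have i12 : Integrable (fun ω => (G1 ω + G2 ω) / ((s : ℝ) + 1)) P :=
      (i1.add i2).div_const _
    -- The weights `1` and `s + 1` in `(W + x)² ≤ (s + 2)(W² + x² / (s + 1))` make the constant pass
    -- exactly from `(s + 1)²` to `(s + 2)²`.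
    refine ⟨fun ω => ((s : ℝ) + 2) * ((∑ i ∈ Finset.Ico u w, T i ω) ^ 2 +
      (G1 ω + G2 ω) / ((s : ℝ) + 1)), (iW.add i12).const_mul _, fun ω => ?_,
      fun ω m h1 h2 => ?_, ?_⟩
    · have := n1 ω
      have := n2 ω
      positivity
    · have hn1 := n1 ω
      have hn2 := n2 ω
      rcases le_total m w with hmw | hmw
      · have := m1 ω m h1 hmw
        have h3 : G1 ω ≤ ((s : ℝ) + 2) * ((G1 ω + G2 ω) / ((s : ℝ) + 1)) := by
          rw [← mul_div_assoc, le_div_iff₀ hs0]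
          nlinarith
        nlinarith [sq_nonneg (∑ i ∈ Finset.Ico u w, T i ω)]
      · have := m2 ω m hmw h2
        rw [← Finset.sum_Ico_consecutive _ huw hmw]
        set W := ∑ i ∈ Finset.Ico u w, T i ω
        set x := ∑ i ∈ Finset.Ico w m, T i ω
        have h3 : (W + x) ^ 2 ≤ ((s : ℝ) + 2) * (W ^ 2 + x ^ 2 / ((s : ℝ) + 1)) := by
          have : ((s : ℝ) + 2) * (W ^ 2 + x ^ 2 / ((s : ℝ) + 1)) - (W + x) ^ 2 =
              (((s : ℝ) + 1) * W - x) ^ 2 / ((s : ℝ) + 1) := by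
            field_simp
            ring
          have h4 : 0 ≤ (((s : ℝ) + 1) * W - x) ^ 2 / ((s : ℝ) + 1) := by positivity
          linarith
        refine h3.trans (mul_le_mul_of_nonneg_left (add_le_add_right ?_ _) (by positivity))
        gcongr
        linarith
    · have hsum : ∑ i ∈ Finset.Ico u v, a i =
          ∑ i ∈ Finset.Ico u w, a i + ∑ i ∈ Finset.Ico w v, a i :=
        (Finset.sum_Ico_consecutive _ huw hwv).symm
      have ha2 : 0 ≤ ∑ i ∈ Finset.Ico w v, a i := Finset.sum_nonneg fun i _ => h.nonneg i
      rw [integral_const_mul, integral_add iW i12, integral_div, integral_add i1 i2, hsum]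
      push_cast
      set a1 := ∑ i ∈ Finset.Ico u w, a i
      set a2 := ∑ i ∈ Finset.Ico w v, a i
      have h3 : (∫ ω, G1 ω ∂P + ∫ ω, G2 ω ∂P) / ((s : ℝ) + 1) ≤
          ((s : ℝ) + 1) * C * (a1 + a2) := by
        rw [div_le_iff₀ hs0]
        linarith
      have h4 : 0 ≤ C * a2 := mul_nonneg h.const_nonneg ha2
      calc _ ≤ ((s : ℝ) + 2) * (C * a1 + C * a2 + ((s : ℝ) + 1) * C * (a1 + a2)) :=
            mul_le_mul_of_nonneg_left (by linarith) (by positivity)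
        _ = _ := by ring

/-- With `B m = a 0 + ⋯ + a (m - 1)`, cut the range each time `B` doubles. On a stretch the weighted
sum is controlled by the first weight and the maximal inequality. The deterministic factor is a
potential whose drop over a stretch pays for that stretch. Each completed stretch contributes at
least `1 / 2` to `∑ a i / B i`, so this sum counts the stretches; the extra `1` is for the last,
incomplete one. -/
theorem exists_weighted_tail {s : ℕ} (hs : N ≤ 2 ^ s) (ha0 : 0 < a 0) (d : ℕ) :
    ∀ u, 1 ≤ u → u ≤ N → N - u ≤ d →
    ∃ G : Ω → ℝ, Integrable G P ∧ (∀ ω, 0 ≤ G ω) ∧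
      (∀ ω, ∀ γ : ℕ → ℝ, Antitone γ → (∀ i, 0 ≤ γ i) →
        (∑ i ∈ Finset.Ico u N, γ i * T i ω) ^ 2 ≤
          G ω * (∑ i ∈ Finset.Ico u N, a i * γ i ^ 2 +
            (∑ i ∈ Finset.range u, a i) * γ u ^ 2 / 4)) ∧
      ∫ ω, G ω ∂P ≤ 16 * C * ((s : ℝ) + 1) ^ 2 *
        (1 + 2 * ∑ i ∈ Finset.Ico u N, a i / ∑ l ∈ Finset.range i, a l) := by
  have hC := h.const_nonneg
  set B : ℕ → ℝ := fun m => ∑ l ∈ Finset.range m, a l with hB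
  have hBpos : ∀ m, 1 ≤ m → 0 < B m := fun m hm =>
    ha0.trans_le (Finset.single_le_sum (f := a) (fun i _ => h.nonneg i)
      (Finset.mem_range.2 hm))
  have hBsub : ∀ m m', m ≤ m' → ∑ i ∈ Finset.Ico m m', a i = B m' - B m := fun m m' hm =>
    Finset.sum_Ico_eq_sub _ hm
  have hBmono : ∀ m m', m ≤ m' → B m ≤ B m' := fun m m' hm => by
    have := hBsub m m' hm
    have : 0 ≤ ∑ i ∈ Finset.Ico m m', a i := Finset.sum_nonneg fun i _ => h.nonneg i
    linarith
  have hL1 : (1 : ℝ) ≤ ((s : ℝ) + 1) ^ 2 := by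
    have : (0 : ℝ) ≤ s := by positivity
    nlinarith
  have hfrac : ∀ m m', 1 ≤ m → 0 ≤ ∑ i ∈ Finset.Ico m m', a i / B i := fun m m' hm =>
    Finset.sum_nonneg fun i hi => div_nonneg (h.nonneg i)
      (hBpos i (hm.trans (Finset.mem_Ico.1 hi).1)).le
  induction d with
  | zero =>
    intro u hu huN hd
    have : u = N := by omega
    subst this
    exact ⟨fun _ => 0, integrable_zero _ _ _, fun _ => le_rfl, fun ω γ _ _ => by simp, by
      simp; positivity⟩
  | succ d ih =>
    intro u hu huN hd
    have hBu := hBpos u hu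
    by_cases hex : ∃ v, u < v ∧ v ≤ N ∧ 2 * B u ≤ B v
    · classical
      obtain ⟨v, ⟨huv, hvN, hBv⟩, hmin⟩ : ∃ v, (u < v ∧ v ≤ N ∧ 2 * B u ≤ B v) ∧
          ∀ w, w < v → ¬ (u < w ∧ w ≤ N ∧ 2 * B u ≤ B w) :=
        ⟨Nat.find hex, Nat.find_spec hex, fun w hw => Nat.find_min hex hw⟩
      -- The index `t` at which `B` crosses `2 * B u` is treated alone, because `a t` may be far
      -- larger than `B u`; before it `B` stays below `2 * B u`.
      obtain ⟨t, rfl⟩ : ∃ t, v = t + 1 := ⟨v - 1, by omega⟩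
      have hBlt : ∀ w, u ≤ w → w ≤ t → B w < 2 * B u := by
        intro w h1 h2
        rcases eq_or_lt_of_le h1 with rfl | h3
        · linarith
        · by_contra hcon
          exact hmin w (by omega) ⟨h3, by omega, by linarith⟩
      have hut : u ≤ t := by omega
      have hBt : B (t + 1) = B t + a t := Finset.sum_range_succ _ _
      have hat : 0 < a t := by
        have := hBlt t hut le_rfl
        linarith
      obtain ⟨G0, i0, n0, m0, e0⟩ := h.exists_maximal s u t hut (by omega) (by omega)
      obtain ⟨G1, i1, n1, m1, e1⟩ := ih (t + 1) (by omega) hvN (by omega)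
      have iT : Integrable (fun ω => T t ω ^ 2) P := (h.memLp t).integrable_sq
      have ig : Integrable (fun ω => G0 ω / B u + T t ω ^ 2 / a t) P :=
        (i0.div_const _).add (iT.div_const _)
      refine ⟨fun ω => 8 * (G0 ω / B u + T t ω ^ 2 / a t) + G1 ω, (ig.const_mul _).add i1,
        fun ω => ?_, fun ω γ hγ hγ0 => ?_, ?_⟩
      · have := n0 ω
        have := n1 ω
        positivity
      · have hn0 := n0 ω
        have hn1 := n1 ω
        have hx := sq_sum_mul_le (T := fun i => T i ω) hγ hγ0 hut (m0 ω)
        have hz := m1 ω γ hγ hγ0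
        -- Half of the energy of the stretch pays for the new boundary term, using `B (t + 1) - B u
        -- ≥ B (t + 1) / 2`; the other half covers `a t * γ t ^ 2 / 4`.
        have hΔ : (B u * γ u ^ 2 + a t * γ t ^ 2) / 4 ≤
            (∑ i ∈ Finset.Ico u N, a i * γ i ^ 2 + B u * γ u ^ 2 / 4) -
            (∑ i ∈ Finset.Ico (t + 1) N, a i * γ i ^ 2 + B (t + 1) * γ (t + 1) ^ 2 / 4) := by
          have h1 : ∑ i ∈ Finset.Ico u N, a i * γ i ^ 2 =
              ∑ i ∈ Finset.Ico u (t + 1), a i * γ i ^ 2 +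
                ∑ i ∈ Finset.Ico (t + 1) N, a i * γ i ^ 2 :=
            (Finset.sum_Ico_consecutive _ (by omega) hvN).symm
          have h2 : (B (t + 1) - B u) * γ (t + 1) ^ 2 ≤
              ∑ i ∈ Finset.Ico u (t + 1), a i * γ i ^ 2 := by
            rw [← hBsub u (t + 1) (by omega), Finset.sum_mul]
            refine Finset.sum_le_sum fun i hi => ?_
            have := (Finset.mem_Ico.1 hi).2
            exact mul_le_mul_of_nonneg_left
              (pow_le_pow_left₀ (hγ0 _) (hγ (by omega)) 2) (h.nonneg i)
          have h3 : a t * γ t ^ 2 ≤ ∑ i ∈ Finset.Ico u (t + 1), a i * γ i ^ 2 :=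
            Finset.single_le_sum (f := fun i => a i * γ i ^ 2)
              (fun i _ => mul_nonneg (h.nonneg i) (sq_nonneg _))
              (Finset.mem_Ico.2 ⟨hut, by omega⟩)
          have h4 : B (t + 1) / 2 * γ (t + 1) ^ 2 ≤ (B (t + 1) - B u) * γ (t + 1) ^ 2 :=
            mul_le_mul_of_nonneg_right (by linarith) (sq_nonneg _)
          have h5 : 0 ≤ a t * γ t ^ 2 := by positivity
          linarith
        have hΨ : 0 ≤ ∑ i ∈ Finset.Ico (t + 1) N, a i * γ i ^ 2 +
            B (t + 1) * γ (t + 1) ^ 2 / 4 :=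
          add_nonneg (Finset.sum_nonneg fun i _ => mul_nonneg (h.nonneg i) (sq_nonneg _))
            (by have := hBpos (t + 1) (by omega); positivity)
        have hxy : (∑ i ∈ Finset.Ico u t, γ i * T i ω + γ t * T t ω) ^ 2 ≤
            (8 * (G0 ω / B u + T t ω ^ 2 / a t)) *
            ((∑ i ∈ Finset.Ico u N, a i * γ i ^ 2 + B u * γ u ^ 2 / 4) -
            (∑ i ∈ Finset.Ico (t + 1) N, a i * γ i ^ 2 +
              B (t + 1) * γ (t + 1) ^ 2 / 4)) := by
          have h1 : (∑ i ∈ Finset.Ico u t, γ i * T i ω) ^ 2 ≤ (G0 ω / B u) * (B u * γ u ^ 2) :=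
            hx.trans (le_of_eq (by field_simp))
          have h2 : (γ t * T t ω) ^ 2 ≤ (T t ω ^ 2 / a t) * (a t * γ t ^ 2) :=
            le_of_eq (by field_simp)
          have h3 := sq_add_le_mul_add (by positivity) (by positivity) (by positivity)
            (by positivity) h1 h2
          refine h3.trans ?_
          have h4 : 0 ≤ G0 ω / B u + T t ω ^ 2 / a t := by positivity
          have h5 : 0 ≤ B u * γ u ^ 2 + a t * γ t ^ 2 := by positivity
          nlinarith [mul_le_mul_of_nonneg_left hΔ h4, mul_nonneg h4 h5]
        have hsplit : ∑ i ∈ Finset.Ico u N, γ i * T i ω =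
            (∑ i ∈ Finset.Ico u t, γ i * T i ω + γ t * T t ω) +
              ∑ i ∈ Finset.Ico (t + 1) N, γ i * T i ω := by
          rw [← Finset.sum_Ico_succ_top hut, Finset.sum_Ico_consecutive _ (by omega) hvN]
        have hΔ0 : 0 ≤ (∑ i ∈ Finset.Ico u N, a i * γ i ^ 2 + B u * γ u ^ 2 / 4) -
            (∑ i ∈ Finset.Ico (t + 1) N, a i * γ i ^ 2 + B (t + 1) * γ (t + 1) ^ 2 / 4) :=
          le_trans (by positivity) hΔ
        rw [hsplit]
        refine (sq_add_le_mul_add (by positivity) hΔ0 hn1 hΨ hxy hz).trans (le_of_eq ?_)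
        ring
      · have e2 := h.integral_sq_le (i := t) (by omega)
        rw [integral_add (ig.const_mul _) i1, integral_const_mul,
          integral_add (i0.div_const _) (iT.div_const _), integral_div, integral_div]
        have e3 : (∫ ω, T t ω ^ 2 ∂P) / a t ≤ C := by rwa [div_le_iff₀ hat]
        have e4 : (∫ ω, G0 ω ∂P) / B u ≤ ((s : ℝ) + 1) ^ 2 * C := by
          rw [div_le_iff₀ hBu]
          refine e0.trans (mul_le_mul_of_nonneg_left ?_ (by positivity))
          rw [hBsub u t hut]
          linarith [hBlt t hut le_rfl]
        -- The numerators add up to at least `B u`, and every denominator is below `2 * B u`.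
        have e5 : (1 : ℝ) / 2 ≤ ∑ i ∈ Finset.Ico u (t + 1), a i / B i := by
          have : (∑ i ∈ Finset.Ico u (t + 1), a i) / (2 * B u) ≤
              ∑ i ∈ Finset.Ico u (t + 1), a i / B i := by
            rw [Finset.sum_div]
            refine Finset.sum_le_sum fun i hi => ?_
            obtain ⟨hi1, hi2⟩ := Finset.mem_Ico.1 hi
            exact div_le_div_of_nonneg_left (h.nonneg i) (hBpos i (by omega))
              (hBlt i hi1 (by omega)).le
          refine le_trans ?_ this
          rw [hBsub u (t + 1) (by omega), le_div_iff₀ (by linarith)]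
          linarith
        have e6 : ∑ i ∈ Finset.Ico u N, a i / B i = ∑ i ∈ Finset.Ico u (t + 1), a i / B i +
            ∑ i ∈ Finset.Ico (t + 1) N, a i / B i :=
          (Finset.sum_Ico_consecutive _ (by omega) hvN).symm
        rw [e6]
        have e7 : C ≤ C * ((s : ℝ) + 1) ^ 2 := le_mul_of_one_le_right hC hL1
        have e8 : C * ((s : ℝ) + 1) ^ 2 * (1 / 2) ≤
            C * ((s : ℝ) + 1) ^ 2 * ∑ i ∈ Finset.Ico u (t + 1), a i / B i :=
          mul_le_mul_of_nonneg_left e5 (by positivity)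
        nlinarith
    · push Not at hex
      have hBN : B N < 2 * B u := by
        rcases eq_or_lt_of_le huN with rfl | h3
        · linarith
        · exact hex N h3 le_rfl
      obtain ⟨G0, i0, n0, m0, e0⟩ := h.exists_maximal s u N huN le_rfl (by omega)
      refine ⟨fun ω => 4 * (G0 ω / B u), (i0.div_const _).const_mul _, fun ω => ?_,
        fun ω γ hγ hγ0 => ?_, ?_⟩
      · have := n0 ω
        positivity
      · have hx := sq_sum_mul_le (T := fun i => T i ω) hγ hγ0 huN (m0 ω)
        have hn0 := n0 ω
        have h1 : 0 ≤ ∑ i ∈ Finset.Ico u N, a i * γ i ^ 2 :=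
          Finset.sum_nonneg fun i _ => mul_nonneg (h.nonneg i) (sq_nonneg _)
        have h2 : γ u ^ 2 * G0 ω = 4 * (G0 ω / B u) * (B u * γ u ^ 2 / 4) := by
          field_simp
        refine hx.trans ?_
        rw [h2]
        exact mul_le_mul_of_nonneg_left (by linarith) (by positivity)
      · rw [integral_const_mul, integral_div]
        have e4 : (∫ ω, G0 ω ∂P) / B u ≤ ((s : ℝ) + 1) ^ 2 * C := by
          rw [div_le_iff₀ hBu]
          refine e0.trans (mul_le_mul_of_nonneg_left ?_ (by positivity))
          rw [hBsub u N huN]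
          linarith
        have e8 : 0 ≤ C * ((s : ℝ) + 1) ^ 2 * ∑ i ∈ Finset.Ico u N, a i / B i :=
          mul_nonneg (by positivity) (hfrac u N hu)
        have e9 : 0 ≤ C * ((s : ℝ) + 1) ^ 2 := by positivity
        nlinarith

/-- Index `0` is split off because the doubling argument needs a positive starting sum; from index
`1` on that sum is at least `a 0`. -/
theorem exists_weighted {s : ℕ} (hs : N ≤ 2 ^ s) (hN : 1 ≤ N) (ha0 : 0 < a 0) :
    ∃ G : Ω → ℝ, Integrable G P ∧ (∀ ω, 0 ≤ G ω) ∧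
      (∀ ω, ∀ γ : ℕ → ℝ, Antitone γ → (∀ i, 0 ≤ γ i) →
        (∑ i ∈ Finset.range N, γ i * T i ω) ^ 2 ≤
          G ω * ∑ i ∈ Finset.range N, a i * γ i ^ 2) ∧
      ∫ ω, G ω ∂P ≤ 34 * C * ((s : ℝ) + 1) ^ 2 *
        (1 + 2 * ∑ i ∈ Finset.Ico 1 N, a i / ∑ l ∈ Finset.range i, a l) := by
  have hC := h.const_nonneg
  obtain ⟨G, i1, n1, m1, e1⟩ := h.exists_weighted_tail hs ha0 (N - 1) 1 le_rfl hN le_rfl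
  have iT : Integrable (fun ω => T 0 ω ^ 2) P := (h.memLp 0).integrable_sq
  have ig : Integrable (fun ω => T 0 ω ^ 2 / a 0 + G ω) P := (iT.div_const _).add i1
  refine ⟨fun ω => 2 * (T 0 ω ^ 2 / a 0 + G ω), ig.const_mul _, fun ω => ?_,
    fun ω γ hγ hγ0 => ?_, ?_⟩
  · have := n1 ω
    positivity
  · have hn1 := n1 ω
    have hz := m1 ω γ hγ hγ0
    rw [Finset.range_eq_Ico, ← Finset.sum_Ico_consecutive _ (Nat.zero_le 1) hN,
      ← Finset.sum_Ico_consecutive (fun i => a i * γ i ^ 2) (Nat.zero_le 1) hN]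
    simp only [Finset.range_one, Finset.sum_singleton, Nat.Ico_zero_eq_range] at hz ⊢
    have h2 : (γ 0 * T 0 ω) ^ 2 ≤ (T 0 ω ^ 2 / a 0) * (a 0 * γ 0 ^ 2) :=
      le_of_eq (by field_simp)
    have h0 : 0 ≤ ∑ i ∈ Finset.Ico 1 N, a i * γ i ^ 2 :=
      Finset.sum_nonneg fun i _ => mul_nonneg (h.nonneg i) (sq_nonneg _)
    have h3 := sq_add_le_mul_add (by positivity) (by positivity) hn1 (by positivity) h2 hz
    refine h3.trans ?_
    have h4 : a 0 * γ 1 ^ 2 ≤ a 0 * γ 0 ^ 2 :=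
      mul_le_mul_of_nonneg_left (pow_le_pow_left₀ (hγ0 _) (hγ (Nat.zero_le 1)) 2) ha0.le
    have h5 : 0 ≤ T 0 ω ^ 2 / a 0 + G ω := by positivity
    have h6 : 0 ≤ a 0 * γ 0 ^ 2 := by positivity
    have := mul_le_mul_of_nonneg_left
      (show a 0 * γ 0 ^ 2 + (∑ i ∈ Finset.Ico 1 N, a i * γ i ^ 2 + a 0 * γ 1 ^ 2 / 4) ≤
        2 * (a 0 * γ 0 ^ 2 + ∑ i ∈ Finset.Ico 1 N, a i * γ i ^ 2) by linarith) h5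
    linarith
  · rw [integral_const_mul, integral_add (iT.div_const _) i1, integral_div]
    have e3 : (∫ ω, T 0 ω ^ 2 ∂P) / a 0 ≤ C := by
      rw [div_le_iff₀ ha0]
      exact h.integral_sq_le hN
    have hfrac : 0 ≤ ∑ i ∈ Finset.Ico 1 N, a i / ∑ l ∈ Finset.range i, a l :=
      Finset.sum_nonneg fun i _ => div_nonneg (h.nonneg i)
        (Finset.sum_nonneg fun l _ => h.nonneg l)
    have hL1 : (1 : ℝ) ≤ ((s : ℝ) + 1) ^ 2 := by
      have : (0 : ℝ) ≤ s := by positivity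
      nlinarith
    have e7 : C ≤ C * ((s : ℝ) + 1) ^ 2 := le_mul_of_one_le_right hC hL1
    have e8 := mul_nonneg (mul_nonneg hC (sq_nonneg ((s : ℝ) + 1))) hfrac
    nlinarith

/-- Plain Cauchy–Schwarz, with no monotonicity of the weights. It supplies the alternative `N` in
the minimum defining the complexity. -/
theorem exists_unordered (h0 : ∀ i, a i = 0 → ∀ ω, T i ω = 0) :
    ∃ G : Ω → ℝ, Integrable G P ∧ (∀ ω, 0 ≤ G ω) ∧
      (∀ ω, ∀ γ : ℕ → ℝ, (∑ i ∈ Finset.range N, γ i * T i ω) ^ 2 ≤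
          G ω * ∑ i ∈ Finset.range N, a i * γ i ^ 2) ∧
      ∫ ω, G ω ∂P ≤ C * N := by
  have iT : ∀ i ∈ Finset.range N, Integrable (fun ω => T i ω ^ 2 / a i) P := fun i _ =>
    (h.memLp i).integrable_sq.div_const _
  refine ⟨fun ω => ∑ i ∈ Finset.range N, T i ω ^ 2 / a i, integrable_finsetSum _ iT,
    fun ω => Finset.sum_nonneg fun i _ => div_nonneg (sq_nonneg _) (h.nonneg i),
    fun ω γ => ?_, ?_⟩
  · refine Finset.sum_sq_le_sum_mul_sum_of_sq_le_mul _
      (fun i _ => div_nonneg (sq_nonneg _) (h.nonneg i))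
      (fun i _ => mul_nonneg (h.nonneg i) (sq_nonneg _)) fun i _ => ?_
    rcases eq_or_ne (a i) 0 with hi | hi
    · simp [h0 i hi ω]
    · exact le_of_eq (by field_simp)
  · rw [integral_finsetSum _ iT]
    calc _ ≤ ∑ i ∈ Finset.range N, C := Finset.sum_le_sum fun i hi => by
          rw [integral_div]
          rcases (h.nonneg i).eq_or_lt with h1 | h1
          · simpa [← h1] using h.const_nonneg
          · rw [div_le_iff₀ h1]
            exact h.integral_sq_le (Finset.mem_range.1 hi)
      _ = C * N := by simp [mul_comm]

/-- A bound for weighted sums that is uniform over nonnegative antitone weights. -/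
theorem exists_uniform (hN : 1 ≤ N) (ha0 : 0 < a 0) (h0 : ∀ i, a i = 0 → ∀ ω, T i ω = 0) :
    ∃ G : Ω → ℝ, Integrable G P ∧ (∀ ω, 0 ≤ G ω) ∧
      (∀ ω, ∀ γ : ℕ → ℝ, Antitone γ → (∀ i, 0 ≤ γ i) →
        (∑ i ∈ Finset.range N, γ i * T i ω) ^ 2 ≤
          G ω * ∑ i ∈ Finset.range N, a i * γ i ^ 2) ∧
      ∫ ω, G ω ∂P ≤ 1088 * C * (min (N : ℝ)
        (1 + ∑ i ∈ Finset.Ico 1 N, a i / (4 * ∑ l ∈ Finset.range i, a l)) *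
          (1 + Real.log N) ^ 2) := by
  have hC := h.const_nonneg
  have hlog : 0 ≤ Real.log N := Real.log_natCast_nonneg N
  rcases le_total (N : ℝ) (1 + ∑ i ∈ Finset.Ico 1 N, a i / (4 * ∑ l ∈ Finset.range i, a l))
    with hle | hle
  · obtain ⟨G, i1, n1, m1, e1⟩ := h.exists_unordered h0
    refine ⟨G, i1, n1, fun ω γ _ _ => m1 ω γ, e1.trans ?_⟩
    rw [min_eq_left hle]
    have h1 : (1 : ℝ) ≤ (1 + Real.log N) ^ 2 := by nlinarith
    have h2 : C * N ≤ C * N * (1 + Real.log N) ^ 2 := le_mul_of_one_le_right (by positivity) h1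
    have h3 : 0 ≤ C * N * (1 + Real.log N) ^ 2 := by positivity
    linarith
  · obtain ⟨G, i1, n1, m1, e1⟩ := h.exists_weighted (Nat.le_pow_clog one_lt_two N) hN ha0
    refine ⟨G, i1, n1, m1, e1.trans ?_⟩
    rw [min_eq_right hle]
    -- This turns the dyadic depth into the natural logarithm. The final constant is `34 · 4 · 8 =
    -- 1088`.
    have hL : ((Nat.clog 2 N : ℕ) : ℝ) + 1 ≤ 2 * (1 + Real.log N) := by
      rcases hN.eq_or_lt with h1 | h1
      · simp [← h1]
      · have h2 := Nat.pow_pred_clog_lt_self one_lt_two h1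
        have h3 : 1 ≤ Nat.clog 2 N := Nat.clog_pos one_lt_two h1
        have h4 : ((2 : ℝ)) ^ (Nat.clog 2 N - 1) ≤ N := by exact_mod_cast h2.le
        have h5 := Real.log_le_log (by positivity) h4
        rw [Real.log_pow, Nat.cast_sub h3] at h5
        have h6 := Real.log_two_gt_d9
        have h7 : (1 : ℝ) ≤ (Nat.clog 2 N : ℕ) := by exact_mod_cast h3
        push_cast at h5
        nlinarith
    have hL2 : (((Nat.clog 2 N : ℕ) : ℝ) + 1) ^ 2 ≤ 4 * (1 + Real.log N) ^ 2 := by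
      calc _ ≤ (2 * (1 + Real.log N)) ^ 2 := pow_le_pow_left₀ (by positivity) hL 2
        _ = _ := by ring
    have hfrac : 0 ≤ ∑ i ∈ Finset.Ico 1 N, a i / ∑ l ∈ Finset.range i, a l :=
      Finset.sum_nonneg fun i _ => div_nonneg (h.nonneg i)
        (Finset.sum_nonneg fun l _ => h.nonneg l)
    have hq : ∑ i ∈ Finset.Ico 1 N, a i / (4 * ∑ l ∈ Finset.range i, a l) =
        (∑ i ∈ Finset.Ico 1 N, a i / ∑ l ∈ Finset.range i, a l) / 4 := by
      rw [Finset.sum_div]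
      exact Finset.sum_congr rfl fun i _ => by rw [div_div, mul_comm]
    rw [hq]
    set S := ∑ i ∈ Finset.Ico 1 N, a i / ∑ l ∈ Finset.range i, a l
    calc _ ≤ 34 * C * (4 * (1 + Real.log N) ^ 2) * (1 + 2 * S) := by gcongr
      _ ≤ 34 * C * (4 * (1 + Real.log N) ^ 2) * (8 * (1 + S / 4)) := by gcongr; linarith
      _ = _ := by ring

end HasIncrementBound

end Maximal

/-! ### Sums over groups and tail weights. -/

section Blocks

variable {p M : ℕ} {k : ℕ → ℕ} {ζ : ℝ}

/-- The indices, counted from `0`, of the groups `u, …, v - 1`. -/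
def block (p : ℕ) (k : ℕ → ℕ) (u v : ℕ) : Finset (Fin p) :=
  Finset.univ.filter (fun l : Fin p => k u ≤ (l : ℕ) ∧ (l : ℕ) < k v)

theorem mem_block {u v : ℕ} {j : Fin p} : j ∈ block p k u v ↔ k u ≤ (j : ℕ) ∧ (j : ℕ) < k v := by
  simp [block]

theorem block_self (u : ℕ) : block p k u u = ∅ := by
  ext j
  simp [mem_block]

theorem tailSum_eq (θ : Fin p → ℝ) (j : ℕ) : tailSum M k θ j = ∑ l ∈ block p k j M, θ l ^ 2 := rfl

namespace IsGrouped

variable (hk : IsGrouped p M k ζ)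
include hk

theorem mono {u v : ℕ} (huv : u ≤ v) (hv : v ≤ M) : k u ≤ k v := by
  induction v, huv using Nat.le_induction with
  | base => exact le_rfl
  | succ v huv ih => exact (ih (by omega)).trans (hk.lt_succ v (by omega)).le

theorem le_p {u : ℕ} (hu : u ≤ M) : k u ≤ p := by
  have := hk.mono hu le_rfl
  rwa [hk.last] at this

theorem sum_block_add {u v w : ℕ} (huv : u ≤ v) (hvw : v ≤ w) (hw : w ≤ M) (F : Fin p → ℝ) :
    ∑ j ∈ block p k u v, F j + ∑ j ∈ block p k v w, F j = ∑ j ∈ block p k u w, F j := by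
  have h1 := hk.mono huv (hvw.trans hw)
  have h2 := hk.mono hvw hw
  rw [← Finset.sum_union]
  · congr 1
    ext j
    simp only [Finset.mem_union, mem_block]
    omega
  · rw [Finset.disjoint_left]
    intro j
    simp only [mem_block]
    omega

theorem sum_block {u v : ℕ} (huv : u ≤ v) (hv : v ≤ M) (F : Fin p → ℝ) :
    ∑ g ∈ Finset.Ico u v, ∑ j ∈ block p k g (g + 1), F j = ∑ j ∈ block p k u v, F j := by
  induction v, huv using Nat.le_induction with
  | base => simp [block_self]
  | succ v huv ih =>
    rw [Finset.sum_Ico_succ_top huv, ih (by omega), hk.sum_block_add huv (by omega) hv]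

theorem sum_block_rev {N u v : ℕ} (huv : u ≤ v) (hv : v ≤ N) (hN : N ≤ M) (F : Fin p → ℝ) :
    ∑ i ∈ Finset.Ico u v, ∑ j ∈ block p k (N - 1 - i) (N - i), F j =
      ∑ j ∈ block p k (N - v) (N - u), F j := by
  induction v, huv using Nat.le_induction with
  | base => simp [block_self]
  | succ v huv ih =>
    rw [Finset.sum_Ico_succ_top huv, ih (by omega), add_comm,
      show N - 1 - v = N - (v + 1) by omega,
      hk.sum_block_add (by omega) (by omega) (by omega)]

theorem block_zero_last : block p k 0 M = Finset.univ := by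
  ext j
  simp [mem_block, hk.zero, hk.last]

theorem sum_univ (F : Fin p → ℝ) :
    ∑ g ∈ Finset.range M, ∑ j ∈ block p k g (g + 1), F j = ∑ j, F j := by
  rw [Finset.range_eq_Ico, hk.sum_block (Nat.zero_le _) le_rfl, hk.block_zero_last]

theorem card_block {u v : ℕ} (huv : u ≤ v) (hv : v ≤ M) :
    ((block p k u v).card : ℝ) = (k v : ℝ) - k u := by
  have h : (block p k u v).card = k v - k u := by
    rw [← Nat.card_Ico, ← Finset.card_map Fin.valEmbedding]
    congr 1
    ext i
    simp only [Finset.mem_map, mem_block, Fin.valEmbedding_apply, Finset.mem_Ico]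
    constructor
    · rintro ⟨j, hj, rfl⟩
      exact hj
    · intro hi
      exact ⟨⟨i, hi.2.trans_le (hk.le_p hv)⟩, hi, rfl⟩
  rw [h, Nat.cast_sub (hk.mono huv hv)]

theorem sum_card_block {u v : ℕ} (huv : u ≤ v) (hv : v ≤ M) :
    ∑ g ∈ Finset.Ico u v, ((block p k g (g + 1)).card : ℝ) = (block p k u v).card := by
  have := hk.sum_block huv hv (fun _ => 1)
  simpa using this

end IsGrouped

/-- The total weight of the models from the one with index `g` on. -/
def tailWeight (w : Fin M → ℝ) (g : ℕ) : ℝ := ∑ m : Fin M, if g ≤ (m : ℕ) then w m else 0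

theorem IsGrouped.shrinkage_eq (hk : IsGrouped p M k ζ) (w : Fin M → ℝ) {g : ℕ} (hg : g < M)
    {j : Fin p} (hj : j ∈ block p k g (g + 1)) : shrinkage k w (j : ℕ) = tailWeight w g := by
  refine Finset.sum_congr rfl fun m _ => ?_
  rw [mem_block] at hj
  have h : (j : ℕ) < k ((m : ℕ) + 1) ↔ g ≤ (m : ℕ) := by
    have hm := m.2
    constructor
    · intro h
      by_contra hcon
      have := hk.mono (show (m : ℕ) + 1 ≤ g by omega) hg.le
      omega
    · intro h
      have := hk.mono (show g + 1 ≤ (m : ℕ) + 1 by omega) (by omega)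
      omega
  simp only [h]

theorem IsGrouped.sum_shrinkage (hk : IsGrouped p M k ζ) (w : Fin M → ℝ) (Φ : ℝ → ℝ)
    (F : Fin p → ℝ) :
    ∑ j : Fin p, Φ (shrinkage k w (j : ℕ)) * F j =
      ∑ g ∈ Finset.range M, Φ (tailWeight w g) * ∑ j ∈ block p k g (g + 1), F j := by
  rw [← hk.sum_univ]
  refine Finset.sum_congr rfl fun g hg => ?_
  rw [Finset.mul_sum]
  exact Finset.sum_congr rfl fun j hj => by
    rw [hk.shrinkage_eq w (Finset.mem_range.1 hg) hj]

section TailWeight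

variable {w : Fin M → ℝ} (hw : w ∈ stdSimplex ℝ (Fin M))
include hw

theorem tailWeight_antitone : Antitone (tailWeight w) := fun g g' h =>
  Finset.sum_le_sum fun m _ => by
    have := hw.1 m
    split_ifs <;> first | omega | linarith

theorem tailWeight_nonneg (g : ℕ) : 0 ≤ tailWeight w g :=
  Finset.sum_nonneg fun m _ => by
    have := hw.1 m
    split_ifs <;> linarith

theorem tailWeight_zero : tailWeight w 0 = 1 := by
  simpa [tailWeight] using hw.2

theorem tailWeight_le_one (g : ℕ) : tailWeight w g ≤ 1 :=
  (tailWeight_antitone hw (Nat.zero_le g)).trans_eq (tailWeight_zero hw)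

theorem shrinkage_nonneg (k : ℕ → ℕ) (j : ℕ) : 0 ≤ shrinkage k w j :=
  Finset.sum_nonneg fun m _ => by
    have := hw.1 m
    split_ifs <;> linarith

theorem shrinkage_le_one (k : ℕ → ℕ) (j : ℕ) : shrinkage k w j ≤ 1 := by
  rw [← hw.2]
  exact Finset.sum_le_sum fun m _ => by
    have := hw.1 m
    split_ifs <;> linarith

end TailWeight

end Blocks

/-! ### Properties of the complexity `ψ`. -/

section Complexity

variable {p M : ℕ} {k : ℕ → ℕ} {ζ : ℝ} {θ : Fin p → ℝ}

theorem tailIndex_mem (hM : 1 ≤ M) :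
    1 ≤ tailIndex M k θ ∧ tailIndex M k θ ≤ M ∧ tailSum M k θ (tailIndex M k θ) = 0 :=
  Nat.sInf_mem (s := {j : ℕ | 1 ≤ j ∧ j ≤ M ∧ tailSum M k θ j = 0})
    ⟨M, hM, le_rfl, by rw [tailSum_eq, block_self, Finset.sum_empty]⟩

theorem tailSum_nonneg (j : ℕ) : 0 ≤ tailSum M k θ j := Finset.sum_nonneg fun _ _ => sq_nonneg _

theorem tailSum_pos {j : ℕ} (hM : 1 ≤ M) (h1 : 1 ≤ j) (h2 : j < tailIndex M k θ) :
    0 < tailSum M k θ j := by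
  refine (tailSum_nonneg j).lt_of_ne fun h => ?_
  exact Nat.notMem_of_lt_sInf h2 ⟨h1, h2.le.trans (tailIndex_mem hM).2.1, h.symm⟩

theorem IsGrouped.tailSum_sub (hk : IsGrouped p M k ζ) {i j : ℕ} (hij : i ≤ j) (hj : j ≤ M) :
    tailSum M k θ i - tailSum M k θ j = ∑ l ∈ block p k i j, θ l ^ 2 := by
  rw [tailSum_eq, tailSum_eq, ← hk.sum_block_add hij hj le_rfl, add_sub_cancel_right]

theorem IsGrouped.sum_size_nonneg (hk : IsGrouped p M k ζ) :
    0 ≤ ∑ j ∈ Finset.Ico 1 M, ((k (j + 1) : ℝ) - (k j : ℝ)) / (4 * (k j : ℝ)) :=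
  Finset.sum_nonneg fun j hj => by
    have h : (k j : ℝ) ≤ k (j + 1) := by
      exact_mod_cast (hk.lt_succ j (Finset.mem_Ico.1 hj).2).le
    exact div_nonneg (by linarith) (by positivity)

theorem IsGrouped.sum_tail_nonneg (hk : IsGrouped p M k ζ) :
    0 ≤ ∑ j ∈ Finset.Ico 1 (tailIndex M k θ),
      (tailSum M k θ (j - 1) - tailSum M k θ j) / (4 * tailSum M k θ j) :=
  Finset.sum_nonneg fun j hj => by
    have h := (tailIndex_mem (k := k) (θ := θ) hk.one_le).2.1
    rw [hk.tailSum_sub (Nat.sub_le _ _) ((Finset.mem_Ico.1 hj).2.le.trans h)]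
    exact div_nonneg (Finset.sum_nonneg fun _ _ => sq_nonneg _)
      (mul_nonneg (by norm_num) (tailSum_nonneg j))

theorem IsGrouped.size_le_psi (hk : IsGrouped p M k ζ) :
    min (M : ℝ) (1 + ∑ j ∈ Finset.Ico 1 M, ((k (j + 1) : ℝ) - (k j : ℝ)) / (4 * (k j : ℝ))) *
      (1 + Real.log M) ^ 2 ≤ psi M k θ := by
  rw [psi]
  have := hk.sum_tail_nonneg (θ := θ)
  exact mul_le_mul_of_nonneg_right (min_le_min le_rfl (by linarith)) (sq_nonneg _)

theorem IsGrouped.tail_le_psi (hk : IsGrouped p M k ζ) :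
    min (tailIndex M k θ : ℝ) (1 + ∑ j ∈ Finset.Ico 1 (tailIndex M k θ),
      (tailSum M k θ (j - 1) - tailSum M k θ j) / (4 * tailSum M k θ j)) *
      (1 + Real.log (tailIndex M k θ)) ^ 2 ≤ psi M k θ := by
  rw [psi]
  have h1 := hk.sum_size_nonneg
  have h2 := hk.sum_tail_nonneg (θ := θ)
  obtain ⟨h3, h4, -⟩ := tailIndex_mem (k := k) (θ := θ) hk.one_le
  have h5 : (0 : ℝ) < tailIndex M k θ := by exact_mod_cast h3
  have h6 : (tailIndex M k θ : ℝ) ≤ M := by exact_mod_cast h4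
  have h7 : 0 ≤ Real.log (tailIndex M k θ) := Real.log_natCast_nonneg _
  refine mul_le_mul (min_le_min h6 (by linarith))
    (pow_le_pow_left₀ (by positivity) (by linarith [Real.log_le_log h5 h6]) 2)
    (sq_nonneg _) (le_min (by positivity) (by linarith))

theorem IsGrouped.psi_nonneg (hk : IsGrouped p M k ζ) : 0 ≤ psi M k θ := by
  refine le_trans ?_ (hk.size_le_psi (θ := θ))
  have := hk.sum_size_nonneg
  positivity

/-- The coefficients enter only through ratios of tail sums and through which of these vanish. Hence
`μ` may replace `θ = μ / √n`. -/
theorem psi_div {r : ℝ} (hr : r ≠ 0) : psi M k (fun j => θ j / r) = psi M k θ := by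
  have h : ∀ j, tailSum M k (fun j => θ j / r) j = tailSum M k θ j / r ^ 2 := fun j => by
    simp only [tailSum, div_pow, Finset.sum_div]
  have h2 : tailIndex M k (fun j => θ j / r) = tailIndex M k θ := by
    simp only [tailIndex, h, div_eq_zero_iff, pow_eq_zero_iff (two_ne_zero), hr, or_false]
  simp only [psi, h, h2]
  congr 3
  refine Finset.sum_congr rfl fun j _ => ?_
  rw [← sub_div, ← mul_div_assoc, div_div_div_cancel_right₀ (pow_ne_zero 2 hr)]

end Complexity

/-! ### Uniform bounds for the quadratic and linear noise terms. -/

section UniformNoise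

variable {n p M : ℕ} {k : ℕ → ℕ} {ζ v κ : ℝ} {Ω : Type*} [MeasurableSpace Ω] {P : Measure Ω}
  [IsProbabilityMeasure P] {e : Fin n → Ω → ℝ} {φ : Fin p → Fin n → ℝ}

/-- The coordinates of the error vector in the increment directions. -/
def noiseCoef (φ : Fin p → Fin n → ℝ) (e : Fin n → Ω → ℝ) (j : Fin p) (ω : Ω) : ℝ :=
  φ j ⬝ᵥ fun i => e i ω

/-- The uniform bound with group sizes as `a`: their partial sums are the `k g`, which reproduces
the first sum in `ψ`. -/
theorem exists_chiSquare_bound (h : IsFourthMomentNoise P e v κ) (hκ : 0 ≤ κ)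
    (hφ : ∀ i j, φ i ⬝ᵥ φ j = if i = j then 1 else 0) (hk : IsGrouped p M k ζ)
    (θ : Fin p → ℝ) :
    ∃ G : Ω → ℝ, Integrable G P ∧ (∀ ω, 0 ≤ G ω) ∧
      (∀ ω, ∀ γ : ℕ → ℝ, Antitone γ → (∀ i, 0 ≤ γ i) →
        (∑ g ∈ Finset.range M, γ g * ∑ j ∈ block p k g (g + 1), (noiseCoef φ e j ω ^ 2 - v)) ^ 2 ≤
          G ω * ∑ g ∈ Finset.range M, γ g ^ 2 * ∑ _j ∈ block p k g (g + 1), (1 : ℝ)) ∧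
      ∫ ω, G ω ∂P ≤ 1088 * (8 * κ) * psi M k θ := by
  have hinc : HasIncrementBound P
      (fun g ω => ∑ j ∈ block p k g (g + 1), (noiseCoef φ e j ω ^ 2 - v))
      (fun g => ((block p k g (g + 1)).card : ℝ)) (8 * κ) M :=
    { memLp := fun g => (h.integral_chiSquare_sq_le hφ _).1
      nonneg := fun g => by positivity
      const_nonneg := by positivity
      le := fun u v huv hv => by
        simp_rw [hk.sum_block huv hv]
        rw [hk.sum_card_block huv hv]
        exact (h.integral_chiSquare_sq_le hφ _).2 }
  have ha0 : (0 : ℝ) < ((block p k 0 (0 + 1)).card : ℝ) := by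
    rw [hk.card_block (Nat.zero_le _) hk.one_le, hk.zero]
    have := hk.lt_succ 0 hk.one_le
    rw [hk.zero] at this
    simpa using this
  obtain ⟨G, i1, n1, m1, e1⟩ := hinc.exists_uniform hk.one_le ha0 (fun g hg ω => by
    have : block p k g (g + 1) = ∅ := by simpa using hg
    rw [this, Finset.sum_empty])
  refine ⟨G, i1, n1, fun ω γ hγ hγ0 => (m1 ω γ hγ hγ0).trans (le_of_eq ?_), e1.trans ?_⟩
  · congr 1
    exact Finset.sum_congr rfl fun g _ => by simp [mul_comm]
  · refine mul_le_mul_of_nonneg_left (le_trans (le_of_eq ?_) (hk.size_le_psi (θ := θ)))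
      (by positivity)
    congr 3
    refine Finset.sum_congr rfl fun g hg => ?_
    obtain ⟨hg1, hg2⟩ := Finset.mem_Ico.1 hg
    rw [hk.card_block (by omega) hg2, Finset.range_eq_Ico,
      hk.sum_card_block (Nat.zero_le _) hg2.le, hk.card_block (Nat.zero_le _) hg2.le, hk.zero]
    simp

theorem noiseCoef_memLp (h : IsFourthMomentNoise P e v κ) (j : Fin p) :
    MemLp (noiseCoef φ e j) 2 P := by
  have := (h.memLp_sum_four (φ j) Finset.univ).mono_exponent (show (2 : ENNReal) ≤ 4 by norm_num)
  exact this

/-- The weights increase with the group, so the groups are read backwards. The partial sums of the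
energies are then the tail sums `S_j`, which reproduces the second sum in `ψ`. Groups from `M'` on
carry no signal and drop out, so the reversed sequence starts with positive energy. -/
theorem exists_linear_bound (h : IsFourthMomentNoise P e v κ) (hv : 0 ≤ v)
    (hφ : ∀ i j, φ i ⬝ᵥ φ j = if i = j then 1 else 0) (hk : IsGrouped p M k ζ)
    (μ : Fin p → ℝ) :
    ∃ G : Ω → ℝ, Integrable G P ∧ (∀ ω, 0 ≤ G ω) ∧
      (∀ ω, ∀ b : ℕ → ℝ, Monotone b → b 0 = 0 →
        (∑ g ∈ Finset.range M, b g * ∑ j ∈ block p k g (g + 1), μ j * noiseCoef φ e j ω) ^ 2 ≤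
          G ω * ∑ g ∈ Finset.range M, b g ^ 2 * ∑ j ∈ block p k g (g + 1), μ j ^ 2) ∧
      ∫ ω, G ω ∂P ≤ 1088 * v * psi M k μ := by
  obtain ⟨hN1, hNM, hN0⟩ := tailIndex_mem (k := k) (θ := μ) hk.one_le
  have hpos : ∀ j, 1 ≤ j → j < tailIndex M k μ → 0 < tailSum M k μ j := fun j h1 h2 =>
    tailSum_pos hk.one_le h1 h2
  have hpsi := hk.tail_le_psi (θ := μ)
  set N := tailIndex M k μ with hN
  have hμ0 : ∀ j ∈ block p k N M, μ j = 0 := fun j hj => by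
    rw [tailSum_eq, Finset.sum_eq_zero_iff_of_nonneg fun _ _ => sq_nonneg _] at hN0
    simpa using hN0 j hj
  have hfirst : ∀ (b : ℕ → ℝ) (F : Fin p → ℝ), (∀ j, μ j = 0 → F j = 0) →
      ∑ g ∈ Finset.range M, b g * ∑ j ∈ block p k g (g + 1), F j =
        ∑ g ∈ Finset.range N, b g * ∑ j ∈ block p k g (g + 1), F j := fun b F hF => by
    rw [Finset.range_eq_Ico, Finset.range_eq_Ico,
      ← Finset.sum_Ico_consecutive _ (Nat.zero_le N) hNM]
    refine add_eq_left.2 (Finset.sum_eq_zero fun g hg => ?_)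
    obtain ⟨hg1, hg2⟩ := Finset.mem_Ico.1 hg
    rw [Finset.sum_eq_zero fun j hj => hF j (hμ0 j ?_), mul_zero]
    rw [mem_block] at hj ⊢
    have h1 := hk.mono hg1 hg2.le
    have h2 := hk.mono (show g + 1 ≤ M from hg2) le_rfl
    omega
  have hsqz : ∀ j, μ j = 0 → μ j ^ 2 = 0 := fun j hj => by rw [hj]; norm_num
  -- If `M' = 1`, only the first group carries signal, and there the weight is `b 0 = 0`.
  rcases hN1.eq_or_lt with hN' | hN'
  · refine ⟨fun _ => 0, integrable_zero _ _ _, fun _ => le_rfl, fun ω b hb hb0 => ?_, ?_⟩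
    · rw [hfirst b _ fun j hj => by rw [hj, zero_mul], ← hN']
      simp [hb0]
    · simpa using mul_nonneg (mul_nonneg (by norm_num) hv) (hk.psi_nonneg (θ := μ))
  have hinc : HasIncrementBound P
      (fun i ω => ∑ j ∈ block p k (N - 1 - i) (N - i), μ j * noiseCoef φ e j ω)
      (fun i => ∑ j ∈ block p k (N - 1 - i) (N - i), μ j ^ 2) v N :=
    { memLp := fun i => memLp_finsetSum _ fun j _ => (noiseCoef_memLp h j).const_mul _
      nonneg := fun i => Finset.sum_nonneg fun _ _ => sq_nonneg _
      const_nonneg := hv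
      le := fun u w huw hw => by
        simp_rw [hk.sum_block_rev huw hw hNM]
        exact (h.integral_linear_sq hφ μ _).le }
  have htail : ∀ i, i ≤ N → ∑ l ∈ Finset.range i, ∑ j ∈ block p k (N - 1 - l) (N - l), μ j ^ 2 =
      tailSum M k μ (N - i) := fun i hi => by
    rw [Finset.range_eq_Ico, hk.sum_block_rev (Nat.zero_le _) hi hNM, Nat.sub_zero,
      ← hk.tailSum_sub (Nat.sub_le _ _) hNM, hN0, sub_zero]
  have ha0 : (0 : ℝ) < ∑ j ∈ block p k (N - 1 - 0) (N - 0), μ j ^ 2 := by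
    have := htail 1 hN1
    rw [Finset.sum_range_one] at this
    rw [this]
    exact hpos _ (by omega) (by omega)
  obtain ⟨G, i1, n1, m1, e1⟩ := hinc.exists_uniform hN1 ha0 (fun i hi ω => by
    rw [Finset.sum_eq_zero_iff_of_nonneg fun _ _ => sq_nonneg _] at hi
    refine Finset.sum_eq_zero fun j hj => ?_
    rw [(pow_eq_zero_iff two_ne_zero).1 (hi j hj), zero_mul])
  have hrev : ∀ (b : ℕ → ℝ) (F : Fin p → ℝ),
      ∑ g ∈ Finset.range N, b g * ∑ j ∈ block p k g (g + 1), F j =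
      ∑ i ∈ Finset.range N, b (N - 1 - i) * ∑ j ∈ block p k (N - 1 - i) (N - i), F j :=
    fun b F => by
      rw [← Finset.sum_range_reflect]
      refine Finset.sum_congr rfl fun i hi => ?_
      have := Finset.mem_range.1 hi
      rw [show N - 1 - i + 1 = N - i by omega]
  refine ⟨G, i1, n1, fun ω b hb hb0 => ?_, e1.trans ?_⟩
  · have hbn : ∀ i, 0 ≤ b i := fun i => hb0 ▸ hb (Nat.zero_le i)
    have := m1 ω (fun i => b (N - 1 - i)) (fun i j hij => hb (by omega)) fun i => hbn _
    rw [hfirst b _ fun j hj => by rw [hj, zero_mul], hfirst (fun g => b g ^ 2) _ hsqz, hrev,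
      hrev (fun g => b g ^ 2)]
    refine this.trans (le_of_eq ?_)
    congr 1
    exact Finset.sum_congr rfl fun i _ => mul_comm _ _
  · refine mul_le_mul_of_nonneg_left (le_trans (le_of_eq ?_) hpsi) (by positivity)
    congr 3
    refine Finset.sum_nbij' (fun i => N - i) (fun i => N - i) ?_ ?_ ?_ ?_ ?_
    · intro i hi
      simp only [Finset.mem_Ico] at hi ⊢
      omega
    · intro i hi
      simp only [Finset.mem_Ico] at hi ⊢
      omega
    · intro i hi
      simp only [Finset.mem_Ico] at hi
      omega
    · intro i hi
      simp only [Finset.mem_Ico] at hi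
      omega
    · intro i hi
      simp only [Finset.mem_Ico] at hi
      rw [htail i hi.2.le, hk.tailSum_sub (Nat.sub_le _ _) ((Nat.sub_le _ _).trans hNM),
        show N - 1 - i = N - i - 1 by omega]

end UniformNoise

/-! ### The pointwise oracle inequality in coordinates. -/

section Oracle

variable {p M : ℕ} {k : ℕ → ℕ} {ζ v : ℝ}

/-- The squared loss, in coordinates, of the estimator with shrinkage factors `γ`. -/
def seqLoss (γ μ ξ : Fin p → ℝ) : ℝ := ∑ j, (γ j * (μ j + ξ j) - μ j) ^ 2

/-- The squared risk, in coordinates, of the estimator with shrinkage factors `γ`. -/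
def seqRisk (v : ℝ) (γ μ : Fin p → ℝ) : ℝ := ∑ j, ((1 - γ j) ^ 2 * μ j ^ 2 + v * γ j ^ 2)

/-- The part of the loss bound that depends only on the nonrandom factors `γ`; its expectation
is the risk of `γ`. -/
def seqComparator (v : ℝ) (γ μ ξ : Fin p → ℝ) : ℝ :=
  ∑ j, ((γ j * (μ j + ξ j) - μ j) ^ 2 - 2 * γ j * (μ j * ξ j + ξ j ^ 2 - v) + 2 * (μ j * ξ j))

/-- The gap between the two sides is exactly the gap between the Mallows sums. -/
theorem seqLoss_le {γ' γ μ ξ : Fin p → ℝ} {s : ℝ}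
    (hopt : ∑ j, ((1 - γ' j) ^ 2 * (μ j + ξ j) ^ 2 + 2 * s * γ' j) ≤
      ∑ j, ((1 - γ j) ^ 2 * (μ j + ξ j) ^ 2 + 2 * s * γ j)) :
    seqLoss γ' μ ξ ≤ seqComparator v γ μ ξ + 2 * ∑ j, γ' j * (ξ j ^ 2 - v) -
      2 * ∑ j, (1 - γ' j) * (μ j * ξ j) + 2 * ((v - s) * ∑ j, (γ' j - γ j)) := by
  have h : seqComparator v γ μ ξ + 2 * ∑ j, γ' j * (ξ j ^ 2 - v) -
      2 * ∑ j, (1 - γ' j) * (μ j * ξ j) + 2 * ((v - s) * ∑ j, (γ' j - γ j)) - seqLoss γ' μ ξ =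
      ∑ j, ((1 - γ j) ^ 2 * (μ j + ξ j) ^ 2 + 2 * s * γ j) -
      ∑ j, ((1 - γ' j) ^ 2 * (μ j + ξ j) ^ 2 + 2 * s * γ' j) := by
    simp only [seqComparator, seqLoss, Finset.mul_sum, ← Finset.sum_add_distrib,
      ← Finset.sum_sub_distrib]
    exact Finset.sum_congr rfl fun j _ => by ring
  linarith

theorem seqLoss_sub_seqRisk (γ μ ξ : Fin p → ℝ) :
    seqLoss γ μ ξ - seqRisk v γ μ = ∑ j, γ j ^ 2 * (ξ j ^ 2 - v) -
      2 * ∑ j, (1 - γ j) * (μ j * ξ j) + 2 * ∑ j, (1 - γ j) ^ 2 * (μ j * ξ j) := by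
  simp only [seqRisk, seqLoss, Finset.mul_sum, ← Finset.sum_add_distrib,
    ← Finset.sum_sub_distrib]
  exact Finset.sum_congr rfl fun j _ => by ring

theorem seqRisk_nonneg (hv : 0 ≤ v) (γ μ : Fin p → ℝ) : 0 ≤ seqRisk v γ μ :=
  Finset.sum_nonneg fun j _ => by positivity

theorem variance_le_seqRisk (γ μ : Fin p → ℝ) : v * ∑ j, γ j ^ 2 ≤ seqRisk v γ μ := by
  rw [Finset.mul_sum]
  exact Finset.sum_le_sum fun j _ => le_add_of_nonneg_left (by positivity)

theorem bias_le_seqRisk (hv : 0 ≤ v) (γ μ : Fin p → ℝ) :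
    ∑ j, (1 - γ j) ^ 2 * μ j ^ 2 ≤ seqRisk v γ μ :=
  Finset.sum_le_sum fun j _ => le_add_of_nonneg_right (by positivity)

/-- AM–GM: `√((G / v) x) ≤ η x + (G / v) / (4η)`. In the application `x` is a risk, to be absorbed.
-/
theorem abs_le_of_sq_le_mul {A G y x η : ℝ} (hA : A ^ 2 ≤ G * y) (hG : 0 ≤ G)
    (hx : 0 ≤ x) (hv : 0 < v) (hyx : v * y ≤ x) (hη : 0 < η) :
    |A| ≤ η * x + G / v / (4 * η) := by
  refine abs_le_of_sq_le_sq ?_ (by positivity)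
  have h1 : G * y ≤ G / v * x := by
    rw [div_mul_eq_mul_div, le_div_iff₀ hv]
    nlinarith
  have h2 : (η * x + G / v / (4 * η)) ^ 2 - G / v * x = (η * x - G / v / (4 * η)) ^ 2 := by
    field_simp
    ring
  have := sq_nonneg (η * x - G / v / (4 * η))
  linarith

theorem le_of_shrunk_le {x y η : ℝ} (hη : 0 < η) (hη' : η ≤ 1 / 22) (hx : 0 ≤ x)
    (h : (1 - 11 * η) * x ≤ y) : x ≤ (1 + 22 * η) * y := by
  have h1 : 0 ≤ 11 * η * (1 - 22 * η) * x := by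
    have : 0 ≤ 1 - 22 * η := by linarith
    positivity
  have h2 := mul_le_mul_of_nonneg_left h (show 0 ≤ 1 + 22 * η by positivity)
  linarith

/-- The uniform bounds are applied at the realized weights: shrinkage factors and their squares are
antitone in the group, and their complements and squared complements are monotone and vanish at the
first group. Since all lie in `[0, 1]`, the energies are parts of the risk. -/
theorem oracle_pointwise (hk : IsGrouped p M k ζ) {w : Fin M → ℝ}
    (hw : w ∈ stdSimplex ℝ (Fin M)) {μ ξ γ : Fin p → ℝ} {s Ga Gb η : ℝ} (hv : 0 < v) (hη : 0 < η)
    (hGa : 0 ≤ Ga) (hGb : 0 ≤ Gb)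
    (ma : ∀ c : ℕ → ℝ, Antitone c → (∀ i, 0 ≤ c i) →
      (∑ g ∈ Finset.range M, c g * ∑ j ∈ block p k g (g + 1), (ξ j ^ 2 - v)) ^ 2 ≤
        Ga * ∑ g ∈ Finset.range M, c g ^ 2 * ∑ _j ∈ block p k g (g + 1), (1 : ℝ))
    (mb : ∀ b : ℕ → ℝ, Monotone b → b 0 = 0 →
      (∑ g ∈ Finset.range M, b g * ∑ j ∈ block p k g (g + 1), μ j * ξ j) ^ 2 ≤
        Gb * ∑ g ∈ Finset.range M, b g ^ 2 * ∑ j ∈ block p k g (g + 1), μ j ^ 2)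
    (hopt : ∑ j : Fin p, ((1 - shrinkage k w j) ^ 2 * (μ j + ξ j) ^ 2 + 2 * s * shrinkage k w j) ≤
      ∑ j, ((1 - γ j) ^ 2 * (μ j + ξ j) ^ 2 + 2 * s * γ j)) :
    seqLoss (fun j : Fin p => shrinkage k w j) μ ξ ≤
      seqComparator v γ μ ξ + 6 * η * seqRisk v (fun j : Fin p => shrinkage k w j) μ +
        2 * η * seqRisk v γ μ + (Ga / v + Gb + 2 * p * (s - v) ^ 2 / v) / (2 * η) ∧
    |seqLoss (fun j : Fin p => shrinkage k w j) μ ξ -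
      seqRisk v (fun j : Fin p => shrinkage k w j) μ| ≤
      5 * η * seqRisk v (fun j : Fin p => shrinkage k w j) μ +
        (Ga / v + Gb + 2 * p * (s - v) ^ 2 / v) / η := by
  set x := seqRisk v (fun j : Fin p => shrinkage k w j) μ with hx
  set r := seqRisk v γ μ with hr
  have hx0 : 0 ≤ x := seqRisk_nonneg hv.le _ _
  have hr0 : 0 ≤ r := seqRisk_nonneg hv.le _ _
  have c0 := tailWeight_nonneg hw
  have c1 := tailWeight_le_one hw
  have canti := tailWeight_antitone hw
  have s0 := shrinkage_nonneg hw k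
  have s1 := shrinkage_le_one hw k
  have hvar : v * ∑ j : Fin p, shrinkage k w j ^ 2 ≤ x := variance_le_seqRisk _ _
  have hbias : ∑ j : Fin p, (1 - shrinkage k w j) ^ 2 * μ j ^ 2 ≤ x := bias_le_seqRisk hv.le _ _
  have a1 : |∑ j : Fin p, shrinkage k w j * (ξ j ^ 2 - v)| ≤ η * x + Ga / v / (4 * η) := by
    refine abs_le_of_sq_le_mul (y := ∑ j : Fin p, shrinkage k w j ^ 2) ?_ hGa hx0 hv hvar hη
    have h1 := ma (tailWeight w) canti c0
    have e1 := hk.sum_shrinkage w (fun c => c) (fun j => ξ j ^ 2 - v)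
    have e2 := hk.sum_shrinkage w (fun c => c ^ 2) (fun _ => 1)
    rw [← e1, ← e2] at h1
    simpa using h1
  have a2 : |∑ j : Fin p, shrinkage k w j ^ 2 * (ξ j ^ 2 - v)| ≤ η * x + Ga / v / (4 * η) := by
    refine abs_le_of_sq_le_mul (y := ∑ j : Fin p, (shrinkage k w j ^ 2) ^ 2) ?_ hGa hx0 hv ?_ hη
    · have h1 := ma (fun g => tailWeight w g ^ 2)
        (fun g g' h => pow_le_pow_left₀ (c0 _) (canti h) 2) (fun g => sq_nonneg _)
      have e1 := hk.sum_shrinkage w (fun c => c ^ 2) (fun j => ξ j ^ 2 - v)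
      have e2 := hk.sum_shrinkage w (fun c => (c ^ 2) ^ 2) (fun _ => 1)
      rw [← e1, ← e2] at h1
      simpa using h1
    · refine le_trans (mul_le_mul_of_nonneg_left (Finset.sum_le_sum fun j _ => ?_) hv.le) hvar
      exact pow_le_of_le_one (sq_nonneg _) (pow_le_one₀ (s0 _) (s1 _)) two_ne_zero
  have bmono : Monotone fun g => 1 - tailWeight w g := fun g g' h => sub_le_sub_left (canti h) 1
  have b00 : 1 - tailWeight w 0 = 0 := by rw [tailWeight_zero hw, sub_self]
  have b1 : |∑ j : Fin p, (1 - shrinkage k w j) * (μ j * ξ j)| ≤ η * x + Gb / (4 * η) := by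
    have := abs_le_of_sq_le_mul (v := 1) (A := ∑ j : Fin p, (1 - shrinkage k w j) * (μ j * ξ j))
      (y := ∑ j : Fin p, (1 - shrinkage k w j) ^ 2 * μ j ^ 2) (G := Gb) (x := x) ?_ hGb hx0
      one_pos (by simpa using hbias) hη
    · simpa using this
    · have h1 := mb _ bmono b00
      have e1 := hk.sum_shrinkage w (fun c => 1 - c) (fun j => μ j * ξ j)
      have e2 := hk.sum_shrinkage w (fun c => (1 - c) ^ 2) (fun j => μ j ^ 2)
      rwa [← e1, ← e2] at h1
  have b2 : |∑ j : Fin p, (1 - shrinkage k w j) ^ 2 * (μ j * ξ j)| ≤ η * x + Gb / (4 * η) := by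
    have := abs_le_of_sq_le_mul (v := 1)
      (A := ∑ j : Fin p, (1 - shrinkage k w j) ^ 2 * (μ j * ξ j))
      (y := ∑ j : Fin p, ((1 - shrinkage k w j) ^ 2) ^ 2 * μ j ^ 2) (G := Gb) (x := x) ?_ hGb hx0
      one_pos ?_ hη
    · simpa using this
    · have h1 := mb (fun g => (1 - tailWeight w g) ^ 2)
        (fun g g' h => pow_le_pow_left₀ (by linarith [c1 g]) (bmono h) 2)
        (by simp only [b00]; norm_num)
      have e1 := hk.sum_shrinkage w (fun c => (1 - c) ^ 2) (fun j => μ j * ξ j)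
      have e2 := hk.sum_shrinkage w (fun c => ((1 - c) ^ 2) ^ 2) (fun j => μ j ^ 2)
      rwa [← e1, ← e2] at h1
    · rw [one_mul]
      refine le_trans (Finset.sum_le_sum fun j _ => ?_) hbias
      refine mul_le_mul_of_nonneg_right ?_ (sq_nonneg _)
      exact pow_le_of_le_one (sq_nonneg _)
        (pow_le_one₀ (by linarith [s1 j]) (by linarith [s0 j])) two_ne_zero
  -- Cauchy–Schwarz over `p` coordinates gives the factor `p`; the sums of squared factors are
  -- bounded by the two risks divided by `v`.
  have d1 : |(v - s) * ∑ j : Fin p, (shrinkage k w j - γ j)| ≤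
      η * (x + r) + 2 * p * (s - v) ^ 2 / v / (4 * η) := by
    refine abs_le_of_sq_le_mul
      (y := ∑ j : Fin p, shrinkage k w j ^ 2 + ∑ j, γ j ^ 2) ?_ (by positivity)
      (add_nonneg hx0 hr0) hv ?_ hη
    · have h1 : (∑ j : Fin p, (shrinkage k w j - γ j)) ^ 2 ≤
          p * ∑ j : Fin p, (shrinkage k w j - γ j) ^ 2 := by
        simpa using sq_sum_le_card_mul_sum_sq (s := (Finset.univ : Finset (Fin p)))
          (f := fun j : Fin p => shrinkage k w j - γ j)
      have h2 : ∑ j : Fin p, (shrinkage k w j - γ j) ^ 2 ≤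
          2 * (∑ j : Fin p, shrinkage k w j ^ 2 + ∑ j, γ j ^ 2) := by
        rw [← Finset.sum_add_distrib, Finset.mul_sum]
        exact Finset.sum_le_sum fun j _ => by nlinarith [sq_nonneg (shrinkage k w j + γ j)]
      calc _ = (s - v) ^ 2 * (∑ j : Fin p, (shrinkage k w j - γ j)) ^ 2 := by ring
        _ ≤ (s - v) ^ 2 * (p * (2 * (∑ j : Fin p, shrinkage k w j ^ 2 + ∑ j, γ j ^ 2))) := by
          refine mul_le_mul_of_nonneg_left (h1.trans ?_) (sq_nonneg _)
          exact mul_le_mul_of_nonneg_left h2 (Nat.cast_nonneg p)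
        _ = _ := by ring
    · rw [mul_add]
      exact add_le_add hvar (variance_le_seqRisk _ _)
  have hD : 0 ≤ 2 * p * (s - v) ^ 2 / v := by positivity
  set D := 2 * p * (s - v) ^ 2 / v
  have hGv : 0 ≤ Ga / v := by positivity
  set E := Ga / v
  rw [abs_le] at a1 a2 b1 b2 d1
  constructor
  · have h1 := seqLoss_le (v := v) hopt
    have h2 : (E + Gb + D) / (2 * η) = 2 * (E / (4 * η)) + 2 * (Gb / (4 * η)) +
        2 * (D / (4 * η)) := by
      field_simp
      ring
    rw [h2]
    linarith [a1.2, b1.1, d1.2]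
  · have h1 := seqLoss_sub_seqRisk (v := v) (fun j : Fin p => shrinkage k w j) μ ξ
    have h2 : (E + Gb + D) / η = 4 * (E / (4 * η)) + 4 * (Gb / (4 * η)) + 4 * (D / (4 * η)) := by
      field_simp
    have h3 : 0 ≤ E / (4 * η) := by positivity
    have h4 : 0 ≤ D / (4 * η) := by positivity
    rw [h1, h2, abs_le]
    constructor <;> linarith [a2.1, a2.2, b1.1, b1.2, b2.1, b2.2]

end Oracle

/-! ### The oracle inequality in expectation. -/

section Expectation

variable {n p M : ℕ} {k : ℕ → ℕ} {ζ v κ : ℝ} {Ω : Type*} [MeasurableSpace Ω] {P : Measure Ω}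
  [IsProbabilityMeasure P] {e : Fin n → Ω → ℝ} {φ : Fin p → Fin n → ℝ}

theorem integral_noiseCoef (h : IsFourthMomentNoise P e v κ) (j : Fin p) :
    ∫ ω, noiseCoef φ e j ω ∂P = 0 := by
  simp only [noiseCoef, dotProduct]
  rw [integral_finsetSum _ fun i _ => ((h.memLp_two i).integrable (by norm_num)).const_mul _]
  simp [integral_const_mul, h.mean]

theorem integral_noiseCoef_sq (h : IsFourthMomentNoise P e v κ)
    (hφ : ∀ i j, φ i ⬝ᵥ φ j = if i = j then 1 else 0) (j : Fin p) :
    ∫ ω, noiseCoef φ e j ω ^ 2 ∂P = v := by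
  simpa [noiseCoef] using h.integral_linear_sq hφ (fun _ => 1) {j}

theorem integral_quadratic_noiseCoef (h : IsFourthMomentNoise P e v κ)
    (hφ : ∀ i j, φ i ⬝ᵥ φ j = if i = j then 1 else 0) (a b c : Fin p → ℝ) :
    Integrable (fun ω => ∑ j, (a j * noiseCoef φ e j ω ^ 2 + b j * noiseCoef φ e j ω + c j)) P ∧
    ∫ ω, ∑ j, (a j * noiseCoef φ e j ω ^ 2 + b j * noiseCoef φ e j ω + c j) ∂P =
      ∑ j, (a j * v + c j) := by
  have i1 : ∀ j, Integrable (fun ω => a j * noiseCoef φ e j ω ^ 2) P := fun j =>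
    (noiseCoef_memLp h j).integrable_sq.const_mul _
  have i2 : ∀ j, Integrable (fun ω => b j * noiseCoef φ e j ω) P := fun j =>
    ((noiseCoef_memLp h j).integrable (by norm_num)).const_mul _
  have i12 : ∀ j, Integrable (fun ω => a j * noiseCoef φ e j ω ^ 2 + b j * noiseCoef φ e j ω) P :=
    fun j => (i1 j).add (i2 j)
  have i3 : ∀ j, Integrable (fun ω => a j * noiseCoef φ e j ω ^ 2 + b j * noiseCoef φ e j ω +
    c j) P := fun j => (i12 j).add (integrable_const _)
  refine ⟨integrable_finsetSum _ fun j _ => i3 j, ?_⟩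
  rw [integral_finsetSum _ fun j _ => i3 j]
  refine Finset.sum_congr rfl fun j _ => ?_
  rw [integral_add (i12 j) (integrable_const _), integral_add (i1 j) (i2 j), integral_const_mul,
    integral_const_mul, integral_noiseCoef h, integral_noiseCoef_sq h hφ]
  simp

theorem integral_seqLoss (h : IsFourthMomentNoise P e v κ)
    (hφ : ∀ i j, φ i ⬝ᵥ φ j = if i = j then 1 else 0) (γ μ : Fin p → ℝ) :
    ∫ ω, seqLoss γ μ (fun j => noiseCoef φ e j ω) ∂P = seqRisk v γ μ := by
  have h1 := (integral_quadratic_noiseCoef h hφ (fun j => γ j ^ 2)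
    (fun j => 2 * γ j * (γ j - 1) * μ j) (fun j => (1 - γ j) ^ 2 * μ j ^ 2)).2
  have h2 : seqRisk v γ μ = ∑ j, (γ j ^ 2 * v + (1 - γ j) ^ 2 * μ j ^ 2) :=
    Finset.sum_congr rfl fun j _ => by ring
  rw [h2, ← h1]
  refine integral_congr_ae (ae_of_all _ fun ω => ?_)
  exact Finset.sum_congr rfl fun j _ => by ring

theorem integral_seqComparator (h : IsFourthMomentNoise P e v κ)
    (hφ : ∀ i j, φ i ⬝ᵥ φ j = if i = j then 1 else 0) (γ μ : Fin p → ℝ) :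
    Integrable (fun ω => seqComparator v γ μ (fun j => noiseCoef φ e j ω)) P ∧
    ∫ ω, seqComparator v γ μ (fun j => noiseCoef φ e j ω) ∂P = seqRisk v γ μ := by
  have h1 := integral_quadratic_noiseCoef h hφ (fun j => γ j ^ 2 - 2 * γ j)
    (fun j => 2 * γ j * (γ j - 1) * μ j - 2 * γ j * μ j + 2 * μ j)
    (fun j => (1 - γ j) ^ 2 * μ j ^ 2 + 2 * γ j * v)
  have h2 : seqRisk v γ μ = ∑ j, ((γ j ^ 2 - 2 * γ j) * v +
      ((1 - γ j) ^ 2 * μ j ^ 2 + 2 * γ j * v)) :=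
    Finset.sum_congr rfl fun j _ => by ring
  have h3 : (fun ω => seqComparator v γ μ (fun j => noiseCoef φ e j ω)) = fun ω =>
      ∑ j, ((γ j ^ 2 - 2 * γ j) * noiseCoef φ e j ω ^ 2 +
        (2 * γ j * (γ j - 1) * μ j - 2 * γ j * μ j + 2 * μ j) * noiseCoef φ e j ω +
        ((1 - γ j) ^ 2 * μ j ^ 2 + 2 * γ j * v)) := by
    ext ω
    exact Finset.sum_congr rfl fun j _ => by ring
  rw [h3, h2]
  exact h1

variable {wh : Ω → Fin M → ℝ}

theorem measurable_shrinkage (hm : Measurable wh) (k : ℕ → ℕ) (j : ℕ) :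
    Measurable fun ω => shrinkage k (wh ω) j := by
  refine Finset.measurable_sum _ fun m _ => ?_
  split_ifs
  · exact (measurable_pi_apply m).comp hm
  · exact measurable_const

theorem measurable_noiseCoef (h : ∀ i, Measurable (e i)) (j : Fin p) :
    Measurable (noiseCoef φ e j) := by
  unfold noiseCoef dotProduct
  exact Finset.measurable_sum _ fun i _ => (h i).const_mul _

theorem integrable_seqRisk (hv : 0 ≤ v) (hm : Measurable wh)
    (hw : ∀ᵐ ω ∂P, wh ω ∈ stdSimplex ℝ (Fin M)) (μ : Fin p → ℝ) :
    Integrable (fun ω => seqRisk v (fun j : Fin p => shrinkage k (wh ω) j) μ) P := by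
  have hms := measurable_shrinkage hm k
  refine Integrable.mono' (integrable_const (∑ j, (μ j ^ 2 + v))) ?_ ?_
  · refine (Finset.measurable_sum _ fun j _ => ?_).aestronglyMeasurable
    exact (((measurable_const.sub (hms j)).pow_const 2).mul_const _).add
      (((hms j).pow_const 2).const_mul _)
  · filter_upwards [hw] with ω hω
    rw [Real.norm_of_nonneg (seqRisk_nonneg hv _ _)]
    refine Finset.sum_le_sum fun j _ => ?_
    have s0 := shrinkage_nonneg hω k j
    have s1 := shrinkage_le_one hω k j
    refine add_le_add (mul_le_of_le_one_left (sq_nonneg _)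
      (pow_le_one₀ (by linarith) (by linarith))) ?_
    exact mul_le_of_le_one_right hv (pow_le_one₀ s0 s1)

theorem integrable_seqLoss (h : IsFourthMomentNoise P e v κ) (hm : Measurable wh)
    (hw : ∀ᵐ ω ∂P, wh ω ∈ stdSimplex ℝ (Fin M)) (μ : Fin p → ℝ) :
    Integrable (fun ω => seqLoss (fun j : Fin p => shrinkage k (wh ω) j) μ
      (fun j => noiseCoef φ e j ω)) P := by
  have hms := measurable_shrinkage hm k
  have hmn := fun j => measurable_noiseCoef (φ := φ) h.meas j
  have hint : Integrable (fun ω => ∑ j, (2 * noiseCoef φ e j ω ^ 2 + 2 * μ j ^ 2)) P :=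
    integrable_finsetSum _ fun j _ =>
      ((noiseCoef_memLp h j).integrable_sq.const_mul _).add (integrable_const _)
  refine Integrable.mono' hint ?_ ?_
  · refine (Finset.measurable_sum _ fun j _ => ?_).aestronglyMeasurable
    exact (((hms j).mul ((hmn j).const_add _)).sub_const _).pow_const 2
  · filter_upwards [hw] with ω hω
    rw [seqLoss, Real.norm_of_nonneg (Finset.sum_nonneg fun j _ => sq_nonneg _)]
    refine Finset.sum_le_sum fun j _ => ?_
    have s0 := shrinkage_nonneg hω k j
    have s1 := shrinkage_le_one hω k j
    set c := shrinkage k (wh ω) j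
    set x := noiseCoef φ e j ω
    have h1 : (c * (μ j + x) - μ j) ^ 2 ≤ 2 * (c ^ 2 * x ^ 2) + 2 * ((1 - c) ^ 2 * μ j ^ 2) := by
      nlinarith [sq_nonneg (c * x + (1 - c) * μ j)]
    have h2 : c ^ 2 * x ^ 2 ≤ x ^ 2 :=
      mul_le_of_le_one_left (sq_nonneg _) (pow_le_one₀ s0 s1)
    have h3 : (1 - c) ^ 2 * μ j ^ 2 ≤ μ j ^ 2 :=
      mul_le_of_le_one_left (sq_nonneg _) (pow_le_one₀ (by linarith) (by linarith))
    linarith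

/-- The oracle inequality for the minimizer of the Mallows criterion. -/
theorem oracle_inequality (h : IsFourthMomentNoise P e v κ) (hv : 0 < v) (hκ : 0 ≤ κ)
    (hφ : ∀ i j, φ i ⬝ᵥ φ j = if i = j then 1 else 0) (hk : IsGrouped p M k ζ)
    (hm : Measurable wh) (hw : ∀ᵐ ω ∂P, wh ω ∈ stdSimplex ℝ (Fin M)) {s : Ω → ℝ}
    (hs : Integrable (fun ω => (s ω - v) ^ 2) P) {μ γ : Fin p → ℝ}
    (hopt : ∀ᵐ ω ∂P, ∑ j : Fin p, ((1 - shrinkage k (wh ω) j) ^ 2 *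
        (μ j + noiseCoef φ e j ω) ^ 2 + 2 * s ω * shrinkage k (wh ω) j) ≤
      ∑ j, ((1 - γ j) ^ 2 * (μ j + noiseCoef φ e j ω) ^ 2 + 2 * s ω * γ j))
    {η : ℝ} (hη : 0 < η) (hη' : η ≤ 1 / 22) :
    ∃ H : ℝ, H ≤ (8704 * κ / v + 1088 * v + 2 / v) *
        (psi M k μ + p * ∫ ω, (s ω - v) ^ 2 ∂P) ∧
      ∫ ω, seqRisk v (fun j : Fin p => shrinkage k (wh ω) j) μ ∂P ≤
        (1 + 22 * η) * ((1 + 2 * η) * seqRisk v γ μ + 3 / 2 * H / η) ∧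
      ∫ ω, seqLoss (fun j : Fin p => shrinkage k (wh ω) j) μ (fun j => noiseCoef φ e j ω) ∂P ≤
        (1 + 5 * η) * ∫ ω, seqRisk v (fun j : Fin p => shrinkage k (wh ω) j) μ ∂P + H / η := by
  obtain ⟨Ga, ia, na, ma, ea⟩ := exists_chiSquare_bound h hκ hφ hk μ
  obtain ⟨Gb, ib, nb, mb, eb⟩ := exists_linear_bound h hv.le hφ hk μ
  have hψ := hk.psi_nonneg (θ := μ)
  have iR := integrable_seqRisk (k := k) hv.le hm hw μ
  have iL := integrable_seqLoss (φ := φ) (k := k) h hm hw μ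
  obtain ⟨iC, eC⟩ := integral_seqComparator h hφ γ μ
  have iD : Integrable (fun ω => 2 * p * (s ω - v) ^ 2 / v) P := (hs.const_mul _).div_const _
  have iab : Integrable (fun ω => Ga ω / v + Gb ω) P := (ia.div_const _).add ib
  have iH : Integrable (fun ω => Ga ω / v + Gb ω + 2 * p * (s ω - v) ^ 2 / v) P := iab.add iD
  have hs0 : 0 ≤ ∫ ω, (s ω - v) ^ 2 ∂P := integral_nonneg fun ω => sq_nonneg _
  have hpt : ∀ᵐ ω ∂P,
      (seqLoss (fun j : Fin p => shrinkage k (wh ω) j) μ (fun j => noiseCoef φ e j ω) ≤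
      seqComparator v γ μ (fun j => noiseCoef φ e j ω) +
        6 * η * seqRisk v (fun j : Fin p => shrinkage k (wh ω) j) μ +
        2 * η * seqRisk v γ μ +
        (Ga ω / v + Gb ω + 2 * p * (s ω - v) ^ 2 / v) / (2 * η)) ∧
      |seqLoss (fun j : Fin p => shrinkage k (wh ω) j) μ (fun j => noiseCoef φ e j ω) -
        seqRisk v (fun j : Fin p => shrinkage k (wh ω) j) μ| ≤
      5 * η * seqRisk v (fun j : Fin p => shrinkage k (wh ω) j) μ +
        (Ga ω / v + Gb ω + 2 * p * (s ω - v) ^ 2 / v) / η := by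
    filter_upwards [hw, hopt] with ω hω hoω
    exact oracle_pointwise hk hω hv hη (na ω) (nb ω) (ma ω) (mb ω) hoω
  refine ⟨∫ ω, (Ga ω / v + Gb ω + 2 * p * (s ω - v) ^ 2 / v) ∂P, ?_, ?_, ?_⟩
  · rw [integral_add iab iD, integral_add (ia.div_const _) ib, integral_div, integral_div,
      integral_const_mul]
    set S := ∫ ω, (s ω - v) ^ 2 ∂P
    have h1 : (∫ ω, Ga ω ∂P) / v ≤ 8704 * κ / v * psi M k μ := by
      rw [div_mul_eq_mul_div]
      exact div_le_div_of_nonneg_right (ea.trans (le_of_eq (by ring))) hv.le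
    have h2 : 2 * p * S / v = 2 / v * (p * S) := by ring
    have h3 : 0 ≤ (8704 * κ / v + 1088 * v) * (p * S) := by positivity
    have h4 : 0 ≤ 2 / v * psi M k μ := by positivity
    rw [h2]
    linarith
  · set X := ∫ ω, seqRisk v (fun j : Fin p => shrinkage k (wh ω) j) μ ∂P with hX
    set H := ∫ ω, (Ga ω / v + Gb ω + 2 * p * (s ω - v) ^ 2 / v) ∂P with hH
    have i1 : Integrable (fun ω => (1 - 11 * η) *
        seqRisk v (fun j : Fin p => shrinkage k (wh ω) j) μ) P := iR.const_mul _
    have i2 : Integrable (fun ω => seqComparator v γ μ (fun j => noiseCoef φ e j ω) +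
      2 * η * seqRisk v γ μ) P := iC.add (integrable_const _)
    have i3 : Integrable (fun ω => 3 / 2 / η *
      (Ga ω / v + Gb ω + 2 * p * (s ω - v) ^ 2 / v)) P := iH.const_mul _
    -- The lower bound `loss ≥ (1 - 5η) risk - D / η` is chained with the upper bound on the loss,
    -- whose own risk term is `6η risk`; hence `11 = 5 + 6` and `3 / 2 = 1 + 1 / 2`.
    have h1 : ∫ ω, (1 - 11 * η) * seqRisk v (fun j : Fin p => shrinkage k (wh ω) j) μ ∂P ≤
        ∫ ω, (seqComparator v γ μ (fun j => noiseCoef φ e j ω) + 2 * η * seqRisk v γ μ +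
          3 / 2 / η * (Ga ω / v + Gb ω + 2 * p * (s ω - v) ^ 2 / v)) ∂P := by
      refine integral_mono_ae i1 (i2.add i3) ?_
      filter_upwards [hpt] with ω hω
      have h2 := (abs_le.1 hω.2).1
      have h3 := hω.1
      set D := Ga ω / v + Gb ω + 2 * p * (s ω - v) ^ 2 / v
      have h4 : 3 / 2 / η * D = D / (2 * η) + D / η := by
        field_simp
        ring
      rw [h4]
      linarith
    rw [integral_add i2 i3, integral_add iC (integrable_const _),
      integral_const_mul (1 - 11 * η), integral_const_mul (3 / 2 / η), eC, ← hX, ← hH] at h1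
    simp only [integral_const, probReal_univ, one_smul] at h1
    have hX0 : 0 ≤ X := integral_nonneg fun ω => seqRisk_nonneg hv.le _ _
    have h5 : 3 / 2 / η * H = 3 / 2 * H / η := by ring
    rw [h5] at h1
    exact le_of_shrunk_le hη hη' hX0 (by linarith only [h1])
  · have i1 : Integrable (fun ω => (1 + 5 * η) *
        seqRisk v (fun j : Fin p => shrinkage k (wh ω) j) μ) P := iR.const_mul _
    rw [← integral_const_mul, ← integral_div, ← integral_add i1 (iH.div_const _)]
    refine integral_mono_ae iL (i1.add (iH.div_const _)) ?_
    filter_upwards [hpt] with ω hω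
    have h2 := (abs_le.1 hω.2).2
    linarith

end Expectation

/-! ### Approximating all nested models by grouped ones. -/

section Comparator

variable {p M : ℕ} {k : ℕ → ℕ} {ζ v : ℝ}

/-- Every antitone sequence that starts at `1` is the sequence of tail weights of some weights. -/
theorem exists_tailWeight_eq (hM : 1 ≤ M) {d : ℕ → ℝ} (hd : Antitone d) (hd0 : ∀ i, 0 ≤ d i)
    (hd1 : d 0 = 1) :
    ∃ w ∈ stdSimplex ℝ (Fin M), ∀ g < M, tailWeight w g = d g := by
  -- The weights are differences of `d`; cutting `d` off at `M` gives the last model the whole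
  -- remainder `d (M - 1)`, so the total is `d 0 = 1`.
  set d' : ℕ → ℝ := fun i => if i < M then d i else 0 with hd'
  have hd'M : d' M = 0 := by simp [hd']
  set w : Fin M → ℝ := fun m => d' m - d' ((m : ℕ) + 1) with hw
  have htail : ∀ g ≤ M, tailWeight w g = d' g := by
    intro g hg
    have h1 : tailWeight w g = ∑ m ∈ Finset.Ico g M, (d' m - d' (m + 1)) := by
      calc tailWeight w g = ∑ m ∈ Finset.range M, if g ≤ m then d' m - d' (m + 1) else 0 :=
            (Finset.sum_range (fun m => if g ≤ m then d' m - d' (m + 1) else 0)).symm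
        _ = _ := by
          rw [← Finset.sum_filter]
          congr 1
          ext m
          simp only [Finset.mem_filter, Finset.mem_range, Finset.mem_Ico]
          omega
    rw [h1, Finset.sum_Ico_eq_sub _ hg, Finset.sum_range_sub', Finset.sum_range_sub', hd'M]
    ring
  refine ⟨w, ⟨fun m => ?_, ?_⟩, fun g hg => ?_⟩
  · have := m.2
    simp only [hw, hd', this, if_true]
    split_ifs
    · exact sub_nonneg.2 (hd (Nat.le_succ _))
    · simpa using hd0 _
  · have := htail 0 (Nat.zero_le _)
    simpa [tailWeight, hd', hd1, show 0 < M from hM] using this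
  · rw [htail g hg.le]
    simp [hd', hg]

theorem isGrouped_all (hp : 1 ≤ p) (hζ : 0 ≤ ζ) : IsGrouped p p (fun j => j) ζ where
  one_le := hp
  zero := rfl
  lt_succ j _ := Nat.lt_succ_self j
  last := rfl
  ratio j hj _ := by
    rw [Nat.cast_sub hj]
    push_cast
    norm_num
    exact hζ

theorem seqRisk_eq (γ μ : Fin p → ℝ) :
    seqRisk v γ μ = ∑ j, (1 - γ j) ^ 2 * μ j ^ 2 + v * ∑ j, γ j ^ 2 := by
  rw [seqRisk, Finset.sum_add_distrib, Finset.mul_sum]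

/-- Grouping the nested models costs at most a factor `1 + ζ` and the variance of the first
group. -/
theorem exists_grouped_seqRisk_le (hk : IsGrouped p M k ζ) (hζ : 0 ≤ ζ) (hv : 0 ≤ v)
    {w : Fin p → ℝ} (hw : w ∈ stdSimplex ℝ (Fin p)) (μ : Fin p → ℝ) :
    ∃ w' ∈ stdSimplex ℝ (Fin M), seqRisk v (fun j : Fin p => shrinkage k w' j) μ ≤
      (1 + ζ) * seqRisk v (fun j : Fin p => shrinkage (fun j => j) w j) μ + v * k 1 := by
  have hp : 1 ≤ p := by
    have h1 : k 0 < k 1 := hk.lt_succ 0 hk.one_le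
    have h2 := hk.le_p hk.one_le
    omega
  have hA := isGrouped_all hp hζ
  have hanti := tailWeight_antitone hw
  have hnn := tailWeight_nonneg hw
  have hle := tailWeight_le_one hw
  have hsA : ∀ j : Fin p, shrinkage (fun j => j) w (j : ℕ) = tailWeight w j := fun j =>
    hA.shrinkage_eq w j.2 (by simp [mem_block])
  -- Each group takes the factor of its first index, the largest in the group, so the bias cannot
  -- grow. The `min` is there because `k` is monotone only up to `M`.
  obtain ⟨w', hw', hd⟩ := exists_tailWeight_eq hk.one_le (d := fun g => tailWeight w (k (min g M)))
    (fun g g' h => hanti (hk.mono (min_le_min_right M h) (min_le_right _ _)))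
    (fun g => hnn _) (by simp only [Nat.zero_min, hk.zero, tailWeight_zero hw])
  have hd2 : ∀ g < M, tailWeight w' g = tailWeight w (k g) := fun g hg => by
    rw [hd g hg, min_eq_left hg.le]
  refine ⟨w', hw', ?_⟩
  have hbias : ∑ j : Fin p, (1 - shrinkage k w' j) ^ 2 * μ j ^ 2 ≤
      ∑ j : Fin p, (1 - shrinkage (fun j => j) w j) ^ 2 * μ j ^ 2 := by
    rw [← hk.sum_univ, ← hk.sum_univ]
    refine Finset.sum_le_sum fun g hg => Finset.sum_le_sum fun j hj => ?_
    have hgM := Finset.mem_range.1 hg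
    rw [hk.shrinkage_eq w' hgM hj, hd2 g hgM, hsA]
    have h1 : tailWeight w j ≤ tailWeight w (k g) := hanti (mem_block.1 hj).1
    have h2 := hle (k g)
    exact mul_le_mul_of_nonneg_right
      (pow_le_pow_left₀ (by linarith) (by linarith) 2) (sq_nonneg _)
  have hvar : ∑ j : Fin p, shrinkage k w' j ^ 2 ≤
      (1 + ζ) * ∑ j : Fin p, shrinkage (fun j => j) w j ^ 2 + k 1 := by
    obtain ⟨m, rfl⟩ : ∃ m, M = m + 1 := ⟨M - 1, by have := hk.one_le; omega⟩
    have h1 := hk.sum_shrinkage w' (fun c => c ^ 2) (fun _ => 1)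
    simp only [mul_one] at h1
    have h2 : ∑ g ∈ Finset.range m, ∑ j ∈ block p k g (g + 1),
        shrinkage (fun j => j) w j ^ 2 ≤ ∑ j : Fin p, shrinkage (fun j => j) w j ^ 2 := by
      rw [← hk.sum_univ (fun j => shrinkage (fun j => j) w j ^ 2), Finset.sum_range_succ]
      exact le_add_of_nonneg_right (Finset.sum_nonneg fun _ _ => sq_nonneg _)
    -- The first group, with factor `1`, costs `k 1`. Every later group is compared with its
    -- predecessor, which is smaller by at most the factor `1 + ζ` and on which all original factors
    -- are at least as large.
    rw [h1, Finset.sum_range_succ']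
    refine add_le_add (le_trans ?_ (mul_le_mul_of_nonneg_left h2 (by linarith))) ?_
    · rw [Finset.mul_sum]
      refine Finset.sum_le_sum fun g hg => ?_
      have hgm := Finset.mem_range.1 hg
      have hr := hk.ratio (g + 1) (by omega) (by omega)
      rw [Nat.add_sub_cancel] at hr
      have hlt : (k g : ℝ) < k (g + 1) := by exact_mod_cast hk.lt_succ g (by omega)
      rw [div_le_iff₀ (by linarith)] at hr
      rw [hd2 (g + 1) (by omega)]
      have hc : tailWeight w (k (g + 1)) ^ 2 * ((k (g + 1) : ℝ) - k g) ≤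
          ∑ j ∈ block p k g (g + 1), shrinkage (fun j => j) w j ^ 2 := by
        rw [← hk.card_block (Nat.le_succ g) (by omega), mul_comm, ← nsmul_eq_mul]
        refine Finset.card_nsmul_le_sum _ _ _ fun j hj => ?_
        rw [hsA]
        exact pow_le_pow_left₀ (hnn _) (hanti (mem_block.1 hj).2.le) 2
      rw [Finset.sum_const, nsmul_eq_mul, mul_one, hk.card_block (Nat.le_succ _) (by omega)]
      calc _ ≤ tailWeight w (k (g + 1)) ^ 2 * ((1 + ζ) * ((k (g + 1) : ℝ) - k g)) :=
            mul_le_mul_of_nonneg_left hr (sq_nonneg _)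
        _ = (1 + ζ) * (tailWeight w (k (g + 1)) ^ 2 * ((k (g + 1) : ℝ) - k g)) := by ring
        _ ≤ _ := mul_le_mul_of_nonneg_left hc (by linarith)
    · rw [tailWeight_zero hw', Finset.sum_const, nsmul_eq_mul,
        hk.card_block (Nat.zero_le _) (by omega), hk.zero]
      simp
  rw [seqRisk_eq, seqRisk_eq]
  have hb0 : 0 ≤ ∑ j : Fin p, (1 - shrinkage (fun j => j) w j) ^ 2 * μ j ^ 2 :=
    Finset.sum_nonneg fun j _ => by positivity
  have h1 := mul_le_mul_of_nonneg_left hvar hv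
  have h2 := mul_nonneg hζ hb0
  linarith

end Comparator

/-! ### From `η`-bounds to asymptotic inequalities. -/

section Asymptotics

theorem asympLE_of_forall {Q R : ℕ → ℝ} (hR : ∀ᶠ n in atTop, 0 < R n)
    (h : ∀ δ > 0, ∀ᶠ n in atTop, Q n ≤ (1 + δ) * R n) : AsympLE Q R := by
  refine ⟨fun n => max (Q n / R n - 1) 0, tendsto_order.2 ⟨fun a ha => ?_, fun a ha => ?_⟩, ?_⟩
  · exact Eventually.of_forall fun n => ha.trans_le (le_max_right _ _)
  · filter_upwards [hR, h (a / 2) (by positivity)] with n h1 h2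
    refine max_lt ?_ ha
    rw [← div_le_iff₀ h1] at h2
    linarith
  · filter_upwards [hR] with n h1
    have h2 : Q n = Q n / R n * R n := by field_simp
    calc Q n = Q n / R n * R n := h2
      _ ≤ _ := mul_le_mul_of_nonneg_right
        (by linarith [le_max_left (Q n / R n - 1) 0]) h1.le

theorem le_of_oracle {R r H x l η : ℝ} (hR : 0 < R) (hη : 0 < η) (hη' : η ≤ 1 / 22)
    (hr : r ≤ (1 + 2 * η) * R) (hH : H ≤ η ^ 2 * R)
    (hx : x ≤ (1 + 22 * η) * ((1 + 2 * η) * r + 3 / 2 * H / η))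
    (hl : l ≤ (1 + 5 * η) * x + H / η) : x ≤ (1 + 50 * η) * R ∧ l ≤ (1 + 50 * η) * R := by
  have h1 : H / η ≤ η * R := by
    rw [div_le_iff₀ hη]
    linarith
  have h2 : 3 / 2 * H / η = 3 / 2 * (H / η) := by ring
  have hx' : x ≤ (1 + 35 * η) * R := by
    have h3 : (1 + 2 * η) * r + 3 / 2 * H / η ≤ (1 + 13 / 2 * η) * R := by
      have h4 := mul_le_mul_of_nonneg_left hr (show 0 ≤ 1 + 2 * η by positivity)
      have h5 : 0 ≤ η * R * (1 / 22 - η) := by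
        have : 0 ≤ 1 / 22 - η := by linarith
        positivity
      have h6 : 0 ≤ η * R := by positivity
      rw [h2]
      linarith
    have h4 := mul_le_mul_of_nonneg_left h3 (show 0 ≤ 1 + 22 * η by positivity)
    have h5 : 0 ≤ η * R * (1 / 22 - η) := by
      have : 0 ≤ 1 / 22 - η := by linarith
      positivity
    linarith
  have h6 : 0 ≤ η * R := by positivity
  refine ⟨by linarith, ?_⟩
  have h4 := mul_le_mul_of_nonneg_left hx' (show 0 ≤ 1 + 5 * η by positivity)
  have h5 : 0 ≤ η * R * (1 / 22 - η) := by
    have : 0 ≤ 1 / 22 - η := by linarith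
    positivity
  linarith

end Asymptotics

/-! ### Translating the regression model into coordinates. -/

section Model

variable {n p M : ℕ} {k : ℕ → ℕ} {c : ℝ≥0} {σ : ℝ} {Ω : Type*} [MeasurableSpace Ω] {P : Measure Ω}
  [IsProbabilityMeasure P] {e : Fin n → Ω → ℝ} {φ : Fin p → Fin n → ℝ}
  {X : Matrix (Fin n) (Fin p) ℝ}

/-- Every nested model contains the first regressor, so its factor is `1` and the risk is at least
`v`. This makes division by the optimal risk legitimate. -/
theorem seqRisk_pos {ζ v : ℝ} (hv : 0 < v) (hk : IsGrouped p M k ζ) {w : Fin p → ℝ}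
    (hw : w ∈ stdSimplex ℝ (Fin p)) (μ : Fin p → ℝ) :
    0 < seqRisk v (fun j : Fin p => shrinkage (fun j => j) w j) μ := by
  have hp : 0 < p := by
    have h1 : k 0 < k 1 := hk.lt_succ 0 hk.one_le
    have h2 := hk.le_p hk.one_le
    omega
  refine lt_of_lt_of_le ?_ (variance_le_seqRisk _ _)
  refine mul_pos hv (lt_of_lt_of_le ?_ (Finset.single_le_sum (fun j _ => sq_nonneg _)
    (Finset.mem_univ (⟨0, hp⟩ : Fin p))))
  have h : shrinkage (fun j => j) w 0 = 1 := by
    simpa [shrinkage] using hw.2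
  simp [h]

theorem loss_eq_seqLoss (hφ : IsIncrementBasis X φ)
    (hX : LinearIndependent ℝ (fun (j : Fin p) (i : Fin n) => X i j)) (w : Fin M → ℝ)
    (β : Fin p → ℝ) (ω : Ω) :
    loss (maEstimator X (nestedModels p M k) w (fun i => (X *ᵥ β) i + e i ω)) (X *ᵥ β) =
      seqLoss (fun j : Fin p => shrinkage k w j) (fun j => φ j ⬝ᵥ (X *ᵥ β))
        (fun j => noiseCoef φ e j ω) / n :=
  loss_maEstimator hφ hX k w β fun i => e i ω

theorem plugInRisk_eq_seqRisk (hφ : IsIncrementBasis X φ)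
    (hX : LinearIndependent ℝ (fun (j : Fin p) (i : Fin n) => X i j)) (w : Fin M → ℝ)
    (β : Fin p → ℝ) :
    plugInRisk X (X *ᵥ β) σ (nestedModels p M k) w =
      seqRisk (σ ^ 2) (fun j : Fin p => shrinkage k w j) (fun j => φ j ⬝ᵥ (X *ᵥ β)) / n :=
  plugInRisk_eq hφ hX k w β σ

theorem maRisk_eq_seqRisk (h : IsNoise P e c σ) (hφ : IsIncrementBasis X φ)
    (hX : LinearIndependent ℝ (fun (j : Fin p) (i : Fin n) => X i j)) (w : Fin M → ℝ)
    (β : Fin p → ℝ) :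
    maRisk P e X (X *ᵥ β) (nestedModels p M k) w =
      seqRisk (σ ^ 2) (fun j : Fin p => shrinkage k w j) (fun j => φ j ⬝ᵥ (X *ᵥ β)) / n := by
  simp only [maRisk, loss_eq_seqLoss hφ hX]
  rw [integral_div, integral_seqLoss h.isFourthMomentNoise (hφ.dotProduct_eq hX)]

theorem seq_le_of_isOptimalWeight (hn : 1 ≤ n) (hφ : IsIncrementBasis X φ)
    (hX : LinearIndependent ℝ (fun (j : Fin p) (i : Fin n) => X i j)) {w w' : Fin M → ℝ}
    (β : Fin p → ℝ) {s : ℝ} {ω : Ω}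
    (hw : IsOptimalWeight
      (mallows X (nestedModels p M k) (fun i => (X *ᵥ β) i + e i ω) s) w)
    (hw' : w' ∈ stdSimplex ℝ (Fin M)) :
    ∑ j : Fin p, ((1 - shrinkage k w j) ^ 2 * (φ j ⬝ᵥ (X *ᵥ β) + noiseCoef φ e j ω) ^ 2 +
        2 * s * shrinkage k w j) ≤
      ∑ j : Fin p, ((1 - shrinkage k w' j) ^ 2 * (φ j ⬝ᵥ (X *ᵥ β) + noiseCoef φ e j ω) ^ 2 +
        2 * s * shrinkage k w' j) := by
  have h : mallows X (nestedModels p M k) (fun i => (X *ᵥ β) i + e i ω) s w ≤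
    mallows X (nestedModels p M k) (fun i => (X *ᵥ β) i + e i ω) s w' := hw.2 hw'
  have hy : ∀ j, (φ j ⬝ᵥ fun i => (X *ᵥ β) i + e i ω) =
      φ j ⬝ᵥ (X *ᵥ β) + noiseCoef φ e j ω := fun j => dotProduct_add _ _ _
  have hn' : (0 : ℝ) < n := by exact_mod_cast hn
  rw [mallows_eq hφ hX, mallows_eq hφ hX, div_le_div_iff_of_pos_right hn'] at h
  simp only [hy] at h
  linarith

end Model

end MMA

/-! ### Asymptotic optimality. -/

theorem theorem3
    {Ω : ℕ → Type*} [∀ n, MeasurableSpace (Ω n)]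
    (P : ∀ n, Measure (Ω n)) [∀ n, IsProbabilityMeasure (P n)]
    -- the regression model with sample size `n`
    (p : ℕ → ℕ) (X : ∀ n, Matrix (Fin n) (Fin (p n)) ℝ) (β : ∀ n, Fin (p n) → ℝ)
    (f : ∀ n, Fin n → ℝ) (ε : ∀ n, Fin n → Ω n → ℝ) (y : ∀ n, Ω n → Fin n → ℝ)
    (c : ℝ≥0) (σ : ℝ) (hσ : 0 < σ)
    (hp : ∀ n, 1 ≤ n → p n ≤ n)
    (hX : ∀ n, 1 ≤ n → LinearIndependent ℝ (fun (j : Fin (p n)) (i : Fin n) => X n i j))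
    (hf : ∀ n, f n = X n *ᵥ β n)
    (hε : ∀ n, 1 ≤ n → MMA.IsNoise (P n) (ε n) c σ)
    (hy : ∀ n ω i, y n ω i = f n i + ε n i ω)
    -- the transformed coefficients
    (φ : ∀ n, Fin (p n) → Fin n → ℝ)
    (hφ : ∀ n, 1 ≤ n → MMA.IsIncrementBasis (X n) (φ n))
    -- the grouped nested candidate models
    (M : ℕ → ℕ) (k : ℕ → ℕ → ℕ) (ζ : ℕ → ℝ) (hζ : ∀ n, 0 ≤ ζ n)
    (hk : ∀ n, 1 ≤ n → MMA.IsGrouped (p n) (M n) (k n) (ζ n))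
    -- the optimal weights for all the nested models
    (wA : ∀ n, Fin (p n) → ℝ)
    (hwA : ∀ n, 1 ≤ n → MMA.IsOptimalWeight
      (MMA.maRisk (P n) (ε n) (X n) (f n) (MMA.allNested (p n))) (wA n))
    -- the variance estimator and the weights that minimize the Mallows criterion
    (s : ∀ n, Ω n → ℝ) (hs : ∀ n, 1 ≤ n → Measurable (s n))
    (hs2 : ∀ᶠ n in atTop, Integrable (fun ω => (s n ω - σ ^ 2) ^ 2) (P n))
    (wh : ∀ n, Ω n → Fin (M n) → ℝ) (hwh_meas : ∀ n, 1 ≤ n → Measurable (wh n))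
    (hwh : ∀ n, 1 ≤ n → ∀ᵐ ω ∂(P n), MMA.IsOptimalWeight
      (MMA.mallows (X n) (MMA.nestedModels (p n) (M n) (k n)) (y n ω) (s n ω)) (wh n ω))
    -- the conditions of the theorem
    (hbdd : IsBoundedUnder (· ≤ ·) atTop (fun n : ℕ => MMA.sqNorm (f n) / n))
    (hζ0 : Tendsto ζ atTop (𝓝 0))
    (hpsi : (fun n : ℕ => max (k n 1 : ℝ)
        (MMA.psi (M n) (k n) (MMA.transformedCoef (φ n) (f n))))
      =o[atTop] fun n : ℕ => (n : ℝ) *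
        MMA.maRisk (P n) (ε n) (X n) (f n) (MMA.allNested (p n)) (wA n))
    (hvar : (fun n : ℕ => (p n : ℝ) * ∫ ω, (s n ω - σ ^ 2) ^ 2 ∂(P n))
      =o[atTop] fun n : ℕ => (n : ℝ) *
        MMA.maRisk (P n) (ε n) (X n) (f n) (MMA.allNested (p n)) (wA n)) :
    ((∀ n, 1 ≤ n → Integrable (fun ω => MMA.loss
        (MMA.maEstimator (X n) (MMA.nestedModels (p n) (M n) (k n)) (wh n ω) (y n ω)) (f n))
        (P n)) ∧
      MMA.AsympLE
        (fun n => ∫ ω, MMA.loss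
          (MMA.maEstimator (X n) (MMA.nestedModels (p n) (M n) (k n)) (wh n ω) (y n ω)) (f n)
          ∂(P n))
        (fun n => MMA.maRisk (P n) (ε n) (X n) (f n) (MMA.allNested (p n)) (wA n))) ∧
    ((∀ n, 1 ≤ n → Integrable (fun ω => MMA.plugInRisk (X n) (f n) σ
        (MMA.nestedModels (p n) (M n) (k n)) (wh n ω)) (P n)) ∧
      MMA.AsympLE
        (fun n => ∫ ω, MMA.plugInRisk (X n) (f n) σ
          (MMA.nestedModels (p n) (M n) (k n)) (wh n ω) ∂(P n))
        (fun n => MMA.maRisk (P n) (ε n) (X n) (f n) (MMA.allNested (p n)) (wA n))) := by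
  obtain rfl : f = fun n => X n *ᵥ β n := funext hf
  obtain rfl : y = fun n ω i => (X n *ᵥ β n) i + ε n i ω :=
    funext fun n => funext fun ω => funext fun i => hy n ω i
  beta_reduce at *
  have hv : 0 < σ ^ 2 := by positivity
  have hw : ∀ n, 1 ≤ n → ∀ᵐ ω ∂(P n), wh n ω ∈ stdSimplex ℝ (Fin (M n)) := fun n hn =>
    (hwh n hn).mono fun ω hω => hω.1
  set μ : ∀ n, Fin (p n) → ℝ := fun n j => φ n j ⬝ᵥ (X n *ᵥ β n) with hμ
  set R : ℕ → ℝ := fun n =>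
    MMA.seqRisk (σ ^ 2) (fun j : Fin (p n) => MMA.shrinkage (fun j => j) (wA n) j) (μ n) with hRdef
  set x : ℕ → ℝ := fun n => ∫ ω, MMA.seqRisk (σ ^ 2)
    (fun j : Fin (p n) => MMA.shrinkage (k n) (wh n ω) j) (μ n) ∂(P n) with hx
  set l : ℕ → ℝ := fun n => ∫ ω, MMA.seqLoss
    (fun j : Fin (p n) => MMA.shrinkage (k n) (wh n ω) j) (μ n)
    (fun j => MMA.noiseCoef (φ n) (ε n) j ω) ∂(P n) with hl
  have hlossω : ∀ n, 1 ≤ n → ∀ ω, MMA.loss (MMA.maEstimator (X n)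
      (MMA.nestedModels (p n) (M n) (k n)) (wh n ω) (fun i => (X n *ᵥ β n) i + ε n i ω))
      (X n *ᵥ β n) = MMA.seqLoss (fun j : Fin (p n) => MMA.shrinkage (k n) (wh n ω) j) (μ n)
        (fun j => MMA.noiseCoef (φ n) (ε n) j ω) / n := fun n hn ω =>
    MMA.loss_eq_seqLoss (hφ n hn) (hX n hn) (wh n ω) (β n) ω
  have hriskω : ∀ n, 1 ≤ n → ∀ ω, MMA.plugInRisk (X n) (X n *ᵥ β n) σ
      (MMA.nestedModels (p n) (M n) (k n)) (wh n ω) = MMA.seqRisk (σ ^ 2)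
        (fun j : Fin (p n) => MMA.shrinkage (k n) (wh n ω) j) (μ n) / n := fun n hn ω =>
    MMA.plugInRisk_eq_seqRisk (hφ n hn) (hX n hn) (wh n ω) (β n)
  have hoptR : ∀ n, 1 ≤ n → MMA.maRisk (P n) (ε n) (X n) (X n *ᵥ β n) (MMA.allNested (p n))
      (wA n) = R n / n := fun n hn =>
    MMA.maRisk_eq_seqRisk (hε n hn) (hφ n hn) (hX n hn) (wA n) (β n)
  have hnR : ∀ n : ℕ, 1 ≤ n → (n : ℝ) * MMA.maRisk (P n) (ε n) (X n) (X n *ᵥ β n)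
      (MMA.allNested (p n)) (wA n) = R n := fun n hn => by
    have : (n : ℝ) ≠ 0 := by positivity
    rw [hoptR n hn]
    field_simp
  have hRpos : ∀ n, 1 ≤ n → 0 < R n := fun n hn => MMA.seqRisk_pos hv (hk n hn) (hwA n hn).1 _
  have key : ∀ δ > 0, ∀ᶠ n in atTop, 1 ≤ n ∧ x n ≤ (1 + δ) * R n ∧ l n ≤ (1 + δ) * R n := by
    intro δ hδ
    obtain ⟨η, hη, hη', hηδ⟩ : ∃ η : ℝ, 0 < η ∧ η ≤ 1 / 22 ∧ 50 * η ≤ δ :=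
      ⟨min (1 / 22) (δ / 50), by positivity, min_le_left _ _, by
        have := min_le_right (1 / 22) (δ / 50)
        linarith⟩
    set K : ℝ := 8704 * (48 * Real.exp (c / 2)) / σ ^ 2 + 1088 * σ ^ 2 + 2 / σ ^ 2 with hK
    have hKpos : 0 < K := by positivity
    -- With `K` the constant of the oracle inequality, `ψ` and the variance-estimation term each get
    -- half of the budget `η² R`; the second threshold below ensures `σ² k_1 ≤ η R`.
    have hc1 : 0 < η ^ 2 / (2 * K) := by positivity
    have hc2 : 0 < η / σ ^ 2 := by positivity
    filter_upwards [eventually_ge_atTop 1, hs2, hpsi.def hc1, hpsi.def hc2, hvar.def hc1,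
      hζ0.eventually (eventually_le_nhds hη)] with n hn hsn h1 h2 h3 h4
    have hRn := hRpos n hn
    rw [hnR n hn, Real.norm_of_nonneg hRn.le] at h1 h2 h3
    have hψ : MMA.psi (M n) (k n) (MMA.transformedCoef (φ n) (X n *ᵥ β n)) =
        MMA.psi (M n) (k n) (μ n) :=
      MMA.psi_div (Real.sqrt_ne_zero'.2 (by exact_mod_cast hn))
    rw [hψ] at h1 h2
    have h1' := ((le_max_right _ _).trans (le_abs_self _)).trans h1
    have h2' := ((le_max_left _ _).trans (le_abs_self _)).trans h2
    have h3' := (le_abs_self _).trans h3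
    obtain ⟨w', hw', hr⟩ := MMA.exists_grouped_seqRisk_le (hk n hn) (hζ n) hv.le (hwA n hn).1 (μ n)
    obtain ⟨H, hH, hx1, hl1⟩ := MMA.oracle_inequality (hε n hn).isFourthMomentNoise hv
      (by positivity) ((hφ n hn).dotProduct_eq (hX n hn)) (hk n hn) (hwh_meas n hn) (hw n hn) hsn
      (μ := μ n) (γ := fun j : Fin (p n) => MMA.shrinkage (k n) w' j)
      ((hwh n hn).mono fun ω hω =>
        MMA.seq_le_of_isOptimalWeight hn (hφ n hn) (hX n hn) (β n) hω hw') hη hη'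
    have hr' : MMA.seqRisk (σ ^ 2) (fun j : Fin (p n) => MMA.shrinkage (k n) w' j) (μ n) ≤
        (1 + 2 * η) * R n := by
      have h5 : σ ^ 2 * k n 1 ≤ η * R n := by
        have := mul_le_mul_of_nonneg_left h2' hv.le
        refine this.trans (le_of_eq ?_)
        field_simp
      have h6 := mul_le_mul_of_nonneg_right h4 hRn.le
      linarith
    have hH' : H ≤ η ^ 2 * R n := by
      refine hH.trans ((mul_le_mul_of_nonneg_left (add_le_add h1' h3') hKpos.le).trans
        (le_of_eq ?_))
      field_simp
      ring
    obtain ⟨h7, h8⟩ := MMA.le_of_oracle hRn hη hη' hr' hH' hx1 hl1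
    have h9 := mul_le_mul_of_nonneg_right hηδ hRn.le
    exact ⟨hn, by linarith, by linarith⟩
  have hRpos' : ∀ᶠ n in atTop, 0 < MMA.maRisk (P n) (ε n) (X n) (X n *ᵥ β n)
      (MMA.allNested (p n)) (wA n) := by
    filter_upwards [eventually_ge_atTop 1] with n hn
    have := hRpos n hn
    rw [hoptR n hn]
    positivity
  refine ⟨⟨fun n hn => ?_, MMA.asympLE_of_forall hRpos' fun δ hδ => ?_⟩,
    fun n hn => ?_, MMA.asympLE_of_forall hRpos' fun δ hδ => ?_⟩
  · simp only [hlossω n hn]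
    exact (MMA.integrable_seqLoss (hε n hn).isFourthMomentNoise (hwh_meas n hn) (hw n hn)
      (μ n)).div_const _
  · filter_upwards [key δ hδ] with n hn
    simp only [hlossω n hn.1]
    rw [integral_div, hoptR n hn.1, ← mul_div_assoc]
    exact div_le_div_of_nonneg_right hn.2.2 (Nat.cast_nonneg n)
  · simp only [hriskω n hn]
    exact (MMA.integrable_seqRisk hv.le (hwh_meas n hn) (hw n hn) (μ n)).div_const _
  · filter_upwards [key δ hδ] with n hn
    simp only [hriskω n hn.1]
    rw [integral_div, hoptR n hn.1, ← mul_div_assoc]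
    exact div_le_div_of_nonneg_right hn.2.1 (Nat.cast_nonneg n)
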